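/- **Setting.** Let $F$ be a number field with algebraic closure $\bar F$, let $W_F$ be a Weil group of $F$, and for every non-trivial valuation (finite or archimedean place) $v$ of $F$ let $W_v$ be a Weil group of the completion $F_v$ and $\theta_v:W_v\to W_F$ a Weil map, i.e. a continuous homomorphism for which there is an $F$-embedding $\bar F\to\bar F_v$ such that $\theta_v$ is compatible with the induced restriction map $G_{F_v}\to G_F$ of Galois groups and, for all finite $E/F$ inside $\bar F$ with induced completion $E_v$, with the map $E_v^*\to C_E$ to the idèle class group that puts $a$ at the place of $E$ determined by the embedding and $1$ elsewhere, under the identifications $E_v^*\cong W_{E_v}^{ab}$ and $C_E\cong W_E^{ab}$. Put $W_{\kappa(v)}=\mathbb Z$ if $v$ is finite and $W_{\kappa(v)}=\mathbb R$ if $v$ is archimedean, and let $\pi_v:W_v\to W_v^{ab}\cong F_v^*\to W_{\kappa(v)}$ be given by the normalized valuation, resp. by $\log|\cdot|$. Let $K\subset\bar F$ be a finite Galois extension of $F$, and let $S$ be a finite set of non-trivial valuations of $F$ containing all those (finite or archimedean) that ramify in $K$. Let $U_{K,S}$ be the group of idèles of $K$ that are $1$ at the places over $S$ and units at all other places (at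 an archimedean place a unit is an element of absolute value $1$). Let $N_{K,S}\subseteq W_K\subseteq W_F$ be the preimage of the image of $U_{K,S}$ in $C_K\cong W_K^{ab}$, and $W_{K/F,S}=W_F/N_{K,S}$. For a topological group $G$, let $T_G$ be the site of topological spaces with continuous $G$-action and continuous equivariant maps, a family $\{X_i\to X\}$ being a covering if every point of $X$ has an open neighbourhood with a continuous section to some $X_i$. Let $T_{K,S,\bar Y}$ be the following site. An object $\mathcal X$ consists of a $W_{K/F,S}$-space $X_{v_0}$ ($v_0$ the trivial valuation), a $W_{\kappa(v)}$-space $X_v$ for every non-trivial valuation $v$ of $F$, and continuous $W_v$-equivariant maps $f_v:X_v\to X_{v_0}$, where $W_v$ acts through $\pi_v$ and $\theta_v$ respectively. Morphisms are families of equivariant continuous maps commuting with the $f_v$. A family is a covering if each of its components (at $v_0$ and at every $v$) is a covering in the above sense. For sheaves of abelian groups let $(i_v)_*$ and $j_*=(j_{K,S})_*$ be the direct images $((i_v)_*E)(\mathcal X)=E(X_v)$ from $T_{W_{\kappa(v)}}$ and $(j_*E)(\mathcal X)=E(X_{v_0})$ from $T_{W_{K/F,S}}$; let $i_v^*$ be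 the left adjoint of $(i_v)_*$ and $R^qj_*$ the $q$-th right derived functor of $j_*$. For a topological $W_F$-module $A$ let $\tilde A$ be the sheaf on $T_{W_{K/F,S}}$ whose sections over $X$ are the continuous $W_F$-equivariant maps $X\to A$. **Theorem.** Let $A$ be a topological $W_F$-module, let $q>0$ and let $B=R^q(j_{K,S})_*\tilde A$. Then the natural map $$B\longrightarrow\prod_{v\in S}(i_v)_*i_v^*B$$ whose components are the units of the adjunctions $i_v^*\dashv(i_v)_*$ is an isomorphism of sheaves on $T_{K,S,\bar Y}$. (Since $S$ is finite, the product is also the direct sum.) -/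

import Mathlib

open CategoryTheory Limits Opposite NumberField IsDedekindDomain

universe w u

namespace WeilEtale

/-- A `G`-space: a topological space with a continuous action `G × X → X`. -/
structure GSpace (G : Type w) [Group G] [TopologicalSpace G] : Type (max (u + 1) w) where
  carrier : Type u
  [top : TopologicalSpace carrier]
  [act : MulAction G carrier]
  [cont : ContinuousSMul G carrier]

namespace GSpace

attribute [instance] GSpace.top GSpace.act GSpace.cont

variable {G : Type w} [Group G] [TopologicalSpace G]

instance : CoeSort (GSpace.{w, u} G) (Type u) := ⟨GSpace.carrier⟩

/-- Morphisms of `G`-spaces: continuous equivariant maps. -/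
@[ext]
structure Hom (X Y : GSpace.{w, u} G) : Type u where
  map : C(X, Y)
  map_smul : ∀ (g : G) (x : X), map (g • x) = g • map x

instance : Category.{u} (GSpace.{w, u} G) where
  Hom X Y := Hom X Y
  id X := ⟨ContinuousMap.id X, fun _ _ => rfl⟩
  comp f g := ⟨g.map.comp f.map, fun a x => by simp [f.map_smul, g.map_smul]⟩

@[ext]
theorem hom_ext {X Y : GSpace.{w, u} G} {f g : X ⟶ Y} (h : ∀ x, Hom.map f x = Hom.map g x) :
    f = g :=
  Hom.ext (ContinuousMap.ext h)

@[simp] theorem id_map (X : GSpace.{w, u} G) (x : X) : Hom.map (𝟙 X) x = x := rfl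
@[simp] theorem comp_map {X Y Z : GSpace.{w, u} G} (f : X ⟶ Y) (g : Y ⟶ Z) (x : X) :
    Hom.map (f ≫ g) x = Hom.map g (Hom.map f x) := rfl

/-- The fibre product of `G`-spaces. -/
def fiber {X Y Z : GSpace.{w, u} G} (f : X ⟶ Z) (g : Y ⟶ Z) : GSpace.{w, u} G :=
  letI : MulAction G {p : X × Y // Hom.map f p.1 = Hom.map g p.2} :=
    { smul := fun a p => ⟨a • p.1, by
        simpa [Hom.map_smul] using congrArg (a • ·) p.2⟩
      one_smul := fun p => Subtype.ext (one_smul G p.1)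
      mul_smul := fun a b p => Subtype.ext (mul_smul a b p.1) }
  haveI : ContinuousSMul G {p : X × Y // Hom.map f p.1 = Hom.map g p.2} :=
    ⟨Continuous.subtype_mk (continuous_fst.smul (continuous_subtype_val.comp continuous_snd)) _⟩
  ⟨{p : X × Y // Hom.map f p.1 = Hom.map g p.2}⟩

/-- First projection of the fibre product. -/
def fiberFst {X Y Z : GSpace.{w, u} G} (f : X ⟶ Z) (g : Y ⟶ Z) : fiber f g ⟶ X :=
  ⟨⟨fun p => p.1.1, continuous_fst.comp continuous_subtype_val⟩, fun _ _ => rfl⟩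

/-- Second projection of the fibre product. -/
def fiberSnd {X Y Z : GSpace.{w, u} G} (f : X ⟶ Z) (g : Y ⟶ Z) : fiber f g ⟶ Y :=
  ⟨⟨fun p => p.1.2, continuous_snd.comp continuous_subtype_val⟩, fun _ _ => rfl⟩

theorem fiber_condition {X Y Z : GSpace.{w, u} G} (f : X ⟶ Z) (g : Y ⟶ Z) :
    fiberFst f g ≫ f = fiberSnd f g ≫ g :=
  hom_ext fun p => p.2

/-- The universal property of the fibre product. -/
def fiberLift {X Y Z T : GSpace.{w, u} G} {f : X ⟶ Z} {g : Y ⟶ Z} (a : T ⟶ X) (b : T ⟶ Y)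
    (h : a ≫ f = b ≫ g) : T ⟶ fiber f g :=
  ⟨⟨fun t => ⟨(Hom.map a t, Hom.map b t), congrArg (fun k => Hom.map k t) h⟩,
    Continuous.subtype_mk ((map_continuous (Hom.map a)).prodMk (map_continuous (Hom.map b))) _⟩,
    fun c t => Subtype.ext (Prod.ext (Hom.map_smul a c t) (Hom.map_smul b c t))⟩

theorem fiberLift_fst {X Y Z T : GSpace.{w, u} G} {f : X ⟶ Z} {g : Y ⟶ Z} (a : T ⟶ X)
    (b : T ⟶ Y) (h : a ≫ f = b ≫ g) : fiberLift a b h ≫ fiberFst f g = a := rfl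

theorem fiberLift_snd {X Y Z T : GSpace.{w, u} G} {f : X ⟶ Z} {g : Y ⟶ Z} (a : T ⟶ X)
    (b : T ⟶ Y) (h : a ≫ f = b ≫ g) : fiberLift a b h ≫ fiberSnd f g = b := rfl

/-- A sieve `R` on a `G`-space `X` has local sections if every point of `X` has an open
neighbourhood over which some member of `R` has a continuous (not necessarily equivariant)
section. -/
def HasLocalSections {X : GSpace.{w, u} G} (R : Sieve X) : Prop :=
  ∀ x : X, ∃ (Y : GSpace.{w, u} G) (g : Y ⟶ X), R g ∧
    ∃ V : Set X, IsOpen V ∧ x ∈ V ∧ ∃ s : C(V, Y), ∀ y : V, Hom.map g (s y) = y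

/-- The local-section topology `T_G` on the category of `G`-spaces. A sieve is covering if and
only if it contains a family of maps that admits local sections. -/
def localSectionTopology (G : Type w) [Group G] [TopologicalSpace G] :
    GrothendieckTopology (GSpace.{w, u} G) where
  sieves X := {R | HasLocalSections R}
  top_mem' X x := ⟨X, 𝟙 X, trivial, Set.univ, isOpen_univ, trivial,
    ⟨Subtype.val, continuous_subtype_val⟩, fun _ => rfl⟩
  pullback_stable' X Y R f hR y := by
    obtain ⟨Z, g, hg, V, hV, hyV, s, hs⟩ := hR (Hom.map f y)
    refine ⟨fiber g f, fiberSnd g f, ?_, Hom.map f ⁻¹' V, hV.preimage (map_continuous _), hyV,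
      ⟨fun t => ⟨(s ⟨Hom.map f t, t.2⟩, t), hs ⟨Hom.map f t, t.2⟩⟩, ?_⟩, fun _ => rfl⟩
    · change R (fiberSnd g f ≫ f)
      rw [← fiber_condition]
      exact R.downward_closed hg _
    · fun_prop
  transitive' X R hR T hT x := by
    obtain ⟨Y, g, hg, V, hV, hxV, s, hs⟩ := hR x
    obtain ⟨Z, k, hk, V', hV', hxV', s', hs'⟩ := hT hg (s ⟨x, hxV⟩)
    refine ⟨Z, k ≫ g, hk, Subtype.val '' (s ⁻¹' V'),
      hV.isOpenMap_subtype_val _ (hV'.preimage s.continuous), ⟨⟨x, hxV⟩, hxV', rfl⟩, ?_⟩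
    have hmem : ∀ t : (Subtype.val '' (s ⁻¹' V') : Set X), (t : X) ∈ V := by
      rintro ⟨_, ⟨t, _, rfl⟩⟩; exact t.2
    have hmem' : ∀ t : (Subtype.val '' (s ⁻¹' V') : Set X), s ⟨t, hmem t⟩ ∈ V' := by
      rintro ⟨_, ⟨t, ht, rfl⟩⟩; exact ht
    refine ⟨⟨fun t => s' ⟨s ⟨t, hmem t⟩, hmem' t⟩, by fun_prop⟩, fun t => ?_⟩
    have h1 := hs' ⟨s ⟨t, hmem t⟩, hmem' t⟩
    have h2 := hs ⟨t, hmem t⟩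
    simp only [ContinuousMap.coe_mk, comp_map] at *
    rw [h1, h2]

end GSpace

/-- The groups entering the definition of the site: a group `generic`, groups `special v` indexed
by `v : I`, and groups `loc v` with homomorphisms to both of them. -/
structure GroupDiagram (I : Type u) where
  generic : Type u
  special : I → Type
  loc : I → Type u
  [groupGeneric : Group generic]
  [topGeneric : TopologicalSpace generic]
  [groupSpecial : ∀ v, Group (special v)]
  [topSpecial : ∀ v, TopologicalSpace (special v)]
  [groupLoc : ∀ v, Group (loc v)]
  /-- the homomorphisms `π_v` -/
  toSpecial : ∀ v, loc v →* special v
  /-- the homomorphisms `θ_v` -/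
  toGeneric : ∀ v, loc v →* generic

namespace GroupDiagram

attribute [instance] groupGeneric topGeneric groupSpecial topSpecial groupLoc

variable {I : Type u} (D : GroupDiagram.{u} I)

/-- An object of the site: a `generic`-space, a `special v`-space for every `v`, and for every `v`
a continuous `loc v`-equivariant specialization map `f_v` from the latter to the former. -/
structure Obj : Type (u + 1) where
  gen : GSpace.{u, u} D.generic
  sp : ∀ v, GSpace.{0, u} (D.special v)
  f : ∀ v, C(sp v, gen)
  f_smul : ∀ v (g : D.loc v) (x : sp v),
    f v (D.toSpecial v g • x) = D.toGeneric v g • f v x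

variable {D}

namespace Obj

/-- Morphisms: families of equivariant continuous maps that commute with the `f_v`. -/
@[ext]
structure Hom (X Y : Obj D) : Type u where
  gen : X.gen ⟶ Y.gen
  sp : ∀ v, X.sp v ⟶ Y.sp v
  comm : ∀ v (x : X.sp v), GSpace.Hom.map gen (X.f v x) = Y.f v (GSpace.Hom.map (sp v) x)

instance : Category.{u} (Obj D) where
  Hom X Y := Hom X Y
  id X := ⟨𝟙 _, fun _ => 𝟙 _, fun _ _ => rfl⟩
  comp f g := ⟨f.gen ≫ g.gen, fun v => f.sp v ≫ g.sp v, fun v x => by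
    simp [f.comm, g.comm]⟩

/-- The fibre product, formed componentwise. -/
def fiber {X Y Z : Obj D} (a : X ⟶ Z) (b : Y ⟶ Z) : Obj D where
  gen := GSpace.fiber (Hom.gen a) (Hom.gen b)
  sp v := GSpace.fiber (Hom.sp a v) (Hom.sp b v)
  f v := ⟨fun p => ⟨(X.f v p.1.1, Y.f v p.1.2), by
      rw [Hom.comm, Hom.comm]; exact congrArg (Z.f v) p.2⟩, by
      refine Continuous.subtype_mk (Continuous.prodMk ?_ ?_) _
      · exact (X.f v).continuous.comp (continuous_fst.comp continuous_subtype_val)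
      · exact (Y.f v).continuous.comp (continuous_snd.comp continuous_subtype_val)⟩
  f_smul v g p := Subtype.ext (Prod.ext (X.f_smul v g p.1.1) (Y.f_smul v g p.1.2))

/-- First projection. -/
def fiberFst {X Y Z : Obj D} (a : X ⟶ Z) (b : Y ⟶ Z) : fiber a b ⟶ X :=
  ⟨GSpace.fiberFst _ _, fun _ => GSpace.fiberFst _ _, fun _ _ => rfl⟩

/-- Second projection. -/
def fiberSnd {X Y Z : Obj D} (a : X ⟶ Z) (b : Y ⟶ Z) : fiber a b ⟶ Y :=
  ⟨GSpace.fiberSnd _ _, fun _ => GSpace.fiberSnd _ _, fun _ _ => rfl⟩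

theorem fiber_condition {X Y Z : Obj D} (a : X ⟶ Z) (b : Y ⟶ Z) :
    fiberFst a b ≫ a = fiberSnd a b ≫ b :=
  Hom.ext (GSpace.fiber_condition _ _) (funext fun _ => GSpace.fiber_condition _ _)

end Obj

variable (D)

/-- The functor `𝒳 ↦ X_{v₀}`. -/
def genFunctor : Obj D ⥤ GSpace.{u, u} D.generic where
  obj X := X.gen
  map a := Obj.Hom.gen a

/-- The functor `𝒳 ↦ X_v`. -/
def spFunctor (v : I) : Obj D ⥤ GSpace.{0, u} (D.special v) where
  obj X := X.sp v
  map a := Obj.Hom.sp a v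

/-- A sieve `R` on `𝒳` is covering if its images in the generic component and in every special
component are covering for the local-section topologies, i.e. if `R` contains a family that is a
local section cover in each component. -/
def topology : GrothendieckTopology (Obj D) where
  sieves X := {R | R.functorPushforward (D.genFunctor) ∈
      GSpace.localSectionTopology _ (D.genFunctor.obj X) ∧
    ∀ v, R.functorPushforward (D.spFunctor v) ∈
      GSpace.localSectionTopology _ ((D.spFunctor v).obj X)}
  top_mem' X := by
    refine ⟨?_, fun v => ?_⟩ <;> rw [Sieve.functorPushforward_top] <;>
      exact GrothendieckTopology.top_mem _ _
  pullback_stable' X Y R a hR := by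
    refine ⟨?_, fun v => ?_⟩
    · refine GrothendieckTopology.superset_covering _ ?_
        (GrothendieckTopology.pullback_stable _ (D.genFunctor.map a) hR.1)
      rintro T g ⟨Z, r, h, hr, e⟩
      refine ⟨Obj.fiber r a, Obj.fiberSnd r a, GSpace.fiberLift h g e.symm, ?_, rfl⟩
      change R (Obj.fiberSnd r a ≫ a)
      rw [← Obj.fiber_condition]
      exact R.downward_closed hr _
    · refine GrothendieckTopology.superset_covering _ ?_
        (GrothendieckTopology.pullback_stable _ ((D.spFunctor v).map a) (hR.2 v))
      rintro T g ⟨Z, r, h, hr, e⟩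
      refine ⟨Obj.fiber r a, Obj.fiberSnd r a, GSpace.fiberLift h g e.symm, ?_, rfl⟩
      change R (Obj.fiberSnd r a ≫ a)
      rw [← Obj.fiber_condition]
      exact R.downward_closed hr _
  transitive' X R hR T hT := by
    refine ⟨?_, fun v => ?_⟩
    · refine GrothendieckTopology.transitive _ hR.1 _ ?_
      rintro Y g ⟨Z, r, h, hr, rfl⟩
      rw [Sieve.pullback_comp]
      refine GrothendieckTopology.pullback_stable _ h ?_
      refine GrothendieckTopology.superset_covering _ ?_ (hT hr).1
      rintro Y' g' ⟨Z', r', h', hr', rfl⟩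
      exact ⟨Z', r' ≫ r, h', hr', by simp⟩
    · refine GrothendieckTopology.transitive _ (hR.2 v) _ ?_
      rintro Y g ⟨Z, r, h, hr, rfl⟩
      rw [Sieve.pullback_comp]
      refine GrothendieckTopology.pullback_stable _ h ?_
      refine GrothendieckTopology.superset_covering _ ?_ ((hT hr).2 v)
      rintro Y' g' ⟨Z', r', h', hr', rfl⟩
      exact ⟨Z', r' ≫ r, h', hr', by simp⟩

theorem genFunctor_compatible : CompatiblePreserving.{u + 1}
    (GSpace.localSectionTopology D.generic) D.genFunctor where
  compatible ℱ Z T x hx Y₁ Y₂ X f₁ f₂ g₁ g₂ hg₁ hg₂ e := by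
    have h := hx (Obj.fiberFst g₁ g₂) (Obj.fiberSnd g₁ g₂) hg₁ hg₂ (Obj.fiber_condition g₁ g₂)
    have h' := congrArg (ℱ.obj.map (GSpace.fiberLift f₁ f₂ e).op) h
    refine Eq.trans ?_ (h'.trans ?_)
    · exact Functor.map_comp_apply ℱ.obj (D.genFunctor.map (Obj.fiberFst g₁ g₂)).op
        (GSpace.fiberLift f₁ f₂ e).op (x g₁ hg₁)
    · exact (Functor.map_comp_apply ℱ.obj (D.genFunctor.map (Obj.fiberSnd g₁ g₂)).op
        (GSpace.fiberLift f₁ f₂ e).op (x g₂ hg₂)).symm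

theorem spFunctor_compatible (v : I) : CompatiblePreserving.{u + 1}
    (GSpace.localSectionTopology (D.special v)) (D.spFunctor v) where
  compatible ℱ Z T x hx Y₁ Y₂ X f₁ f₂ g₁ g₂ hg₁ hg₂ e := by
    have h := hx (Obj.fiberFst g₁ g₂) (Obj.fiberSnd g₁ g₂) hg₁ hg₂ (Obj.fiber_condition g₁ g₂)
    have h' := congrArg (ℱ.obj.map (GSpace.fiberLift f₁ f₂ e).op) h
    refine Eq.trans ?_ (h'.trans ?_)
    · exact Functor.map_comp_apply ℱ.obj ((D.spFunctor v).map (Obj.fiberFst g₁ g₂)).op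
        (GSpace.fiberLift f₁ f₂ e).op (x g₁ hg₁)
    · exact (Functor.map_comp_apply ℱ.obj ((D.spFunctor v).map (Obj.fiberSnd g₁ g₂)).op
        (GSpace.fiberLift f₁ f₂ e).op (x g₂ hg₂)).symm

instance : D.genFunctor.IsContinuous D.topology (GSpace.localSectionTopology D.generic) :=
  Functor.isContinuous_of_coverPreserving D.genFunctor_compatible ⟨fun h => h.1⟩

instance (v : I) : (D.spFunctor v).IsContinuous D.topology
    (GSpace.localSectionTopology (D.special v)) :=
  Functor.isContinuous_of_coverPreserving (D.spFunctor_compatible v) ⟨fun h => h.2 v⟩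

end GroupDiagram

/-- Sheaves of abelian groups on the (large) sites used here have enough injectives. -/
instance sheaf_enoughInjectives {C : Type (u + 1)} [Category.{u} C] (J : GrothendieckTopology C) :
    EnoughInjectives (Sheaf J AddCommGrpCat.{u + 1}) := by
  have : EssentiallySmall.{u + 1} C := essentiallySmallSelf.{u + 1} C
  have : IsGrothendieckAbelian.{u + 1} (Sheaf J AddCommGrpCat.{u + 1}) :=
    Sheaf.isGrothendieckAbelian_of_essentiallySmall J _
  infer_instance

instance sheafPushforward_additive {C D : Type (u + 1)} [Category.{u} C] [Category.{u} D]
    (J : GrothendieckTopology C) (K : GrothendieckTopology D) (G : C ⥤ D) [G.IsContinuous J K] :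
    (G.sheafPushforwardContinuous AddCommGrpCat.{u + 1} J K).Additive where
  map_add := by
    intros
    ext
    rfl

namespace GSpace

section Tilde

variable {G : Type u} [Group G] [TopologicalSpace G] {H : Type u} [Group H] (ρ : H →* G)
  (A : Type u) [AddCommGroup A] [TopologicalSpace A] [IsTopologicalAddGroup A]
  [DistribMulAction H A]

/-- The group of continuous `H`-equivariant maps from a `G`-space `X` to `A`, where `H` acts on
`X` through `ρ : H → G`. -/
def equivariantMaps (X : GSpace.{u, u} G) : AddSubgroup C(X, A) where
  carrier := {f | ∀ (h : H) (x : X), f (ρ h • x) = h • f x}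
  add_mem' hf hg h x := by simp [hf h x, hg h x]
  zero_mem' h x := by simp
  neg_mem' hf h x := by simp [hf h x]

/-- The presheaf `X ↦ Map_H(X, A)` on the category of `G`-spaces. -/
def tildePresheaf : (GSpace.{u, u} G)ᵒᵖ ⥤ AddCommGrpCat.{u + 1} where
  obj X := AddCommGrpCat.of (ULift.{u + 1} (equivariantMaps ρ A X.unop))
  map {X Y} a := AddCommGrpCat.ofHom
    { toFun := fun f => ⟨⟨f.down.1.comp (Hom.map a.unop), fun h x => by
        have := f.down.2 h (Hom.map a.unop x)
        simpa [Hom.map_smul] using this⟩⟩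
      map_zero' := rfl
      map_add' := fun _ _ => rfl }
  map_id _ := rfl
  map_comp _ _ := rfl

theorem tildePresheaf_isSheaf :
    Presheaf.IsSheaf (localSectionTopology G) (tildePresheaf ρ A) := by
  rw [Presheaf.isSheaf_iff_isSheaf_forget _ _ (forget AddCommGrpCat.{u + 1}),
    isSheaf_iff_isSheaf_of_type]
  intro X R hR x hx
  have hR' : HasLocalSections R := hR
  -- the value of a member of the family
  let val : ∀ {Y : GSpace.{u, u} G} (g : Y ⟶ X) (_ : R g), C(Y, A) := fun g hg => (x g hg).down.1
  have hval : ∀ {Y Z : GSpace.{u, u} G} (g : Y ⟶ X) (hg : R g) (k : Z ⟶ X) (hk : R k) (y : Y)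
      (z : Z), Hom.map g y = Hom.map k z → val g hg y = val k hk z := by
    intro Y Z g hg k hk y z e
    have h := hx (fiberFst g k) (fiberSnd g k) hg hk (fiber_condition g k)
    exact congrArg (fun t : ULift.{u + 1} (equivariantMaps ρ A (fiber g k)) =>
      t.down.1 ⟨(y, z), e⟩) h
  choose Y g hg V hV hxV s hs using hR'
  let φ : X → A := fun p => val (g p) (hg p) (s p ⟨p, hxV p⟩)
  have hφ : ∀ {Z : GSpace.{u, u} G} (k : Z ⟶ X) (hk : R k) (z : Z), φ (Hom.map k z) = val k hk z :=
    fun k hk z => hval _ _ _ _ _ _ (hs _ _)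
  have hcont : Continuous φ := by
    rw [continuous_iff_continuousAt]
    intro p
    have h1 : ContinuousOn φ (V p) := by
      rw [continuousOn_iff_continuous_domRestrict]
      have : (V p).domRestrict φ = fun t => val (g p) (hg p) (s p t) := by
        funext t
        rw [Set.domRestrict_apply, ← hφ (g p) (hg p), hs]
      rw [this]
      exact (val (g p) (hg p)).continuous.comp (s p).continuous
    exact h1.continuousAt ((hV p).mem_nhds (hxV p))
  have hequiv : ∀ (h : H) (p : X), φ (ρ h • p) = h • φ p := by
    intro h p
    have h1 : ρ h • p = Hom.map (g p) (ρ h • s p ⟨p, hxV p⟩) := by rw [Hom.map_smul, hs]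
    rw [h1, hφ (g p) (hg p)]
    exact (x (g p) (hg p)).down.2 h _
  refine ⟨⟨⟨⟨φ, hcont⟩, hequiv⟩⟩, ?_, ?_⟩
  · intro Z k hk
    refine ULift.ext _ _ (Subtype.ext (ContinuousMap.ext fun z => ?_))
    exact hφ k hk z
  · intro t ht
    refine ULift.ext _ _ (Subtype.ext (ContinuousMap.ext fun p => ?_))
    have h1 := congrArg (fun t : ULift.{u + 1} (equivariantMaps ρ A (Y p)) =>
      t.down.1 (s p ⟨p, hxV p⟩)) (ht (g p) (hg p))
    refine Eq.trans ?_ h1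
    change t.down.1 p = t.down.1 (Hom.map (g p) (s p ⟨p, hxV p⟩))
    rw [hs]

/-- The sheaf `Ã : X ↦ Map_H(X, A)` for the local-section topology. -/
def tilde : Sheaf (localSectionTopology.{u, u} G) AddCommGrpCat.{u + 1} :=
  ⟨tildePresheaf ρ A, tildePresheaf_isSheaf ρ A⟩

end Tilde

end GSpace

namespace GroupDiagram

variable {I : Type u} (D : GroupDiagram.{u} I)

/-- The direct image `j_*` from sheaves on `T_{generic}` to sheaves on the site:
`(j_* E)(𝒳) = E(X_{v₀})`. -/
abbrev genDirectImage : Sheaf (GSpace.localSectionTopology.{u, u} D.generic) AddCommGrpCat.{u + 1} ⥤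
    Sheaf D.topology AddCommGrpCat.{u + 1} :=
  D.genFunctor.sheafPushforwardContinuous _ _ _

/-- The direct image `(i_v)_*`: `((i_v)_* E)(𝒳) = E(X_v)`. -/
abbrev spDirectImage (v : I) :
    Sheaf (GSpace.localSectionTopology.{0, u} (D.special v)) AddCommGrpCat.{u + 1} ⥤
      Sheaf D.topology AddCommGrpCat.{u + 1} :=
  (D.spFunctor v).sheafPushforwardContinuous _ _ _

/-- The inverse image `i_v^*`, the left adjoint of `(i_v)_*`. -/
noncomputable abbrev spInverseImage (v : I) : Sheaf D.topology AddCommGrpCat.{u + 1} ⥤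
    Sheaf (GSpace.localSectionTopology.{0, u} (D.special v)) AddCommGrpCat.{u + 1} :=
  (D.spFunctor v).sheafPullback _ _ _

noncomputable abbrev spAdjunction (v : I) : D.spInverseImage v ⊣ D.spDirectImage v :=
  (D.spFunctor v).sheafAdjunctionContinuous _ _ _

/-- The higher direct image `R^q j_*`. -/
noncomputable abbrev genHigherDirectImage (q : ℕ) :
    Sheaf (GSpace.localSectionTopology.{u, u} D.generic) AddCommGrpCat.{u + 1} ⥤
      Sheaf D.topology AddCommGrpCat.{u + 1} :=
  D.genDirectImage.rightDerived q

/-- The natural map `B ⟶ ∏_{v ∈ S} (i_v)_* i_v^* B` given by the adjunctions. -/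
noncomputable def toProd (S : Finset I) (B : Sheaf D.topology AddCommGrpCat.{u + 1}) :
    B ⟶ ∏ᶜ fun v : S => (D.spDirectImage v.1).obj ((D.spInverseImage v.1).obj B) :=
  Pi.lift fun v : S => (D.spAdjunction v.1).unit.app B

end GroupDiagram

section Places

/-- The non-trivial valuations (up to equivalence) of a number field. -/
inductive Place (F : Type u) [Field F] [NumberField F] : Type u
  | finite (v : HeightOneSpectrum (𝓞 F))
  | infinite (v : InfinitePlace F)

namespace Place

variable {F : Type u} [Field F] [NumberField F]

/-- The completion `F_v`. -/
def Completion : Place F → Type u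
  | finite v => v.adicCompletion F
  | infinite v => v.Completion

noncomputable instance (v : Place F) : Field v.Completion :=
  match v with
  | finite v => inferInstanceAs (Field (v.adicCompletion F))
  | infinite v => inferInstanceAs (Field v.Completion)

noncomputable instance (v : Place F) : TopologicalSpace v.Completion :=
  match v with
  | finite v => inferInstanceAs (TopologicalSpace (v.adicCompletion F))
  | infinite v => inferInstanceAs (TopologicalSpace v.Completion)

noncomputable instance (v : Place F) : Algebra F v.Completion :=
  match v with
  | finite v => inferInstanceAs (Algebra F (v.adicCompletion F))
  | infinite v => inferInstanceAs (Algebra F v.Completion)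

/-- The valuation ring of `F_v` if `v` is non-archimedean, and `F_v` itself otherwise. -/
noncomputable def integers (v : Place F) : Subring v.Completion :=
  match v with
  | finite v => (v.adicCompletionIntegers F).toSubring
  | infinite _ => ⊤

/-- The group `W_{κ(v)}`: `ℤ` if `v` is non-archimedean and `ℝ` if `v` is archimedean, written
multiplicatively. -/
def ResidueGroup : Place F → Type
  | finite _ => Multiplicative ℤ
  | infinite _ => Multiplicative ℝ

noncomputable instance (v : Place F) : CommGroup v.ResidueGroup :=
  match v with
  | finite _ => inferInstanceAs (CommGroup (Multiplicative ℤ))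
  | infinite _ => inferInstanceAs (CommGroup (Multiplicative ℝ))

noncomputable instance (v : Place F) : TopologicalSpace v.ResidueGroup :=
  match v with
  | finite _ => inferInstanceAs (TopologicalSpace (Multiplicative ℤ))
  | infinite _ => inferInstanceAs (TopologicalSpace (Multiplicative ℝ))

/-- The homomorphism `x ↦ log |x|` on the multiplicative group of a normed field. -/
noncomputable def logNormHom (L : Type u) [NormedField L] : Lˣ →* Multiplicative ℝ where
  toFun x := Multiplicative.ofAdd (Real.log ‖(x : L)‖)
  map_one' := by simp
  map_mul' x y := by
    rw [← ofAdd_add, Units.val_mul, norm_mul, Real.log_mul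
      (norm_ne_zero_iff.mpr x.ne_zero) (norm_ne_zero_iff.mpr y.ne_zero)]

/-- The valuation map `F_vˣ → W_{κ(v)}`: the normalized discrete valuation (with value `1` on
uniformizers) if `v` is non-archimedean, and `x ↦ log |x|` if `v` is archimedean. -/
noncomputable def valuation (v : Place F) : v.Completionˣ →* v.ResidueGroup :=
  match v with
  | finite v => (WithZero.unitsWithZeroEquiv.toMonoidHom.comp
      (Units.map (Valued.v : Valuation (v.adicCompletion F) _).toMonoidHom))⁻¹
  | infinite v => logNormHom v.Completion

/-- The `v`-component of an adele. -/
noncomputable def component (v : Place F) : AdeleRing (𝓞 F) F →+* v.Completion :=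
  match v with
  | finite v =>
    { toFun := fun x => (x.2 v : v.adicCompletion F)
      map_one' := rfl
      map_mul' := fun _ _ => rfl
      map_zero' := rfl
      map_add' := fun _ _ => rfl }
  | infinite v =>
    { toFun := fun x => (x.1 v : v.Completion)
      map_one' := rfl
      map_mul' := fun _ _ => rfl
      map_zero' := rfl
      map_add' := fun _ _ => rfl }

variable (F) in
/-- The place of `F` below a place of a finite extension `E`. -/
noncomputable def under {E : Type u} [Field E] [NumberField E] [Algebra F E] : Place E → Place F
  | finite w => finite (w.under (𝓞 F))
  | infinite w => infinite (w.comap (algebraMap F E))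

variable (F) in
/-- The place `w` of `E` is ramified over `F`; an archimedean place is ramified if it is complex
and the place below it is real. -/
def IsRamified {E : Type u} [Field E] [NumberField E] [Algebra F E] : Place E → Prop
  | finite w => w.asIdeal.ramificationIdx (𝓞 F) ≠ 1
  | infinite w => ¬ w.IsUnramified F

end Place

/-- The group of ideles. -/
abbrev Ideles (E : Type u) [Field E] [NumberField E] : Type u := (AdeleRing (𝓞 E) E)ˣ

/-- The idele class group `C_E`. -/
abbrev IdeleClasses (E : Type u) [Field E] [NumberField E] : Type u :=
  Ideles E ⧸ (Units.map (algebraMap E (AdeleRing (𝓞 E) E)).toMonoidHom).range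

/-- The `w`-component of an idele. -/
noncomputable def Ideles.component {E : Type u} [Field E] [NumberField E] (w : Place E) :
    Ideles E →* w.Completionˣ :=
  Units.map w.component.toMonoidHom

/-- The `w`-component of the idele `x` is `a` and its other components are `1`. -/
def Ideles.IsSingle {E : Type u} [Field E] [NumberField E] (w : Place E) (a : w.Completionˣ)
    (x : Ideles E) : Prop :=
  Ideles.component w x = a ∧ ∀ w', w' ≠ w → Ideles.component w' x = 1

/-- The idele `x'` of `E'` is the image of the idele `x` of `E` under the embedding of idele groups
induced by the field embedding `τ : E → E'`. For every place `w'` of `E'` there are exactly one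
place `w` of `E` and one continuous extension `E_w → E'_{w'}` of `τ`; the `w'`-component of `x'`
is the image of the `w`-component of `x`. -/
def Ideles.IsImage {E E' : Type u} [Field E] [NumberField E] [Field E'] [NumberField E']
    (τ : E →+* E') (x : Ideles E) (x' : Ideles E') : Prop :=
  ∀ (w : Place E) (w' : Place E') (c : w.Completion →+* w'.Completion), Continuous c →
    (∀ e : E, c (algebraMap E w.Completion e) = algebraMap E' w'.Completion (τ e)) →
    c (Ideles.component w x) = Ideles.component w' x'

end Places

noncomputable section WeilGroups

/-- A finite extension of `k` in the chosen algebraic closure of `k`. -/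
structure FinExt (k : Type u) [Field k] : Type u where
  field : IntermediateField k (AlgebraicClosure k)
  [finiteDimensional : FiniteDimensional k field]

namespace FinExt

attribute [instance] FinExt.finiteDimensional

instance {F : Type u} [Field F] [NumberField F] (E : FinExt F) : NumberField E.field :=
  NumberField.of_module_finite F E.field

/-- The trivial extension. -/
def base (k : Type u) [Field k] : FinExt k where
  field := ⊥

/-- The identification of the units of the trivial extension with the units of `k`. -/
def baseUnits (k : Type u) [Field k] : (base k).fieldˣ →* kˣ :=
  Units.map (IntermediateField.botEquiv k (AlgebraicClosure k)).toRingEquiv.toMonoidHom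

end FinExt

/-- The class field theoretic data in the definition of a Weil group of `k`: topological groups
`C_E` for the finite extensions `E` of `k`, the relation `a' = τ(a)` for `a ∈ C_E`, `a' ∈ C_{E'}`
and `k`-embeddings `τ : E → E'`, and the characterization of the reciprocity law
`C_E → Gal(k̄/E)^{ab}`. A homomorphism to `Gal(k̄/E)^{ab}` is described by the relation
"`σ ∈ Gal(k̄/E)` represents the image of `a ∈ C_E`". -/
structure ClassFieldData (k : Type u) [Field k] where
  C : FinExt k → Type u
  [group : ∀ E, CommGroup (C E)]
  [top : ∀ E, TopologicalSpace (C E)]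
  IsImage : ∀ {E E' : FinExt k}, (E.field →ₐ[k] E'.field) → C E → C E' → Prop
  IsReciprocity : ∀ E : FinExt k, (C E → Gal(AlgebraicClosure k/k) → Prop) → Prop

attribute [instance] ClassFieldData.group ClassFieldData.top

/-- The preimage `W_E` of `Gal(k̄/E)` under `φ : W → Gal(k̄/k)`. -/
def weilSubgroup {k : Type u} [Field k] {W : Type u} [Group W]
    (φ : W →* Gal(AlgebraicClosure k/k)) (E : FinExt k) : Subgroup W :=
  E.field.fixingSubgroup.comap φ

instance weilSubgroup_finiteIndex {k : Type u} [Field k] {W : Type u} [Group W]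
    (φ : W →* Gal(AlgebraicClosure k/k)) (E : FinExt k) : (weilSubgroup φ E).FiniteIndex := by
  let f : W ⧸ weilSubgroup φ E → (E.field →ₐ[k] AlgebraicClosure k) :=
    Quotient.lift (fun x => (φ x : AlgebraicClosure k →ₐ[k] AlgebraicClosure k).comp E.field.val) <| by
      intro x y h
      have h' : x⁻¹ * y ∈ weilSubgroup φ E := QuotientGroup.leftRel_apply.mp h
      ext e
      have h1 : φ (x⁻¹ * y) e = e := h' e
      rw [map_mul, map_inv] at h1
      have h2 := congrArg (φ x) h1
      simpa using h2.symm
  have hf : Function.Injective f := by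
    intro a b
    induction a using QuotientGroup.induction_on with | H x => ?_
    induction b using QuotientGroup.induction_on with | H y => ?_
    intro h
    refine QuotientGroup.eq.mpr fun e => ?_
    have h1 : φ x e = φ y e := congrArg (fun g => g e) h
    change φ (x⁻¹ * y) e = e
    rw [map_mul, map_inv]
    change (φ x)⁻¹ (φ y e) = e
    rw [← h1]
    exact (φ x).symm_apply_apply _
  have := Finite.of_injective f hf
  exact Subgroup.finiteIndex_of_finite_quotient

/-- The class in `W_E^{ab}` of an element of `W_E`. Here `W_E^{ab}` is the quotient of `W_E` by the
closure of its commutator subgroup. -/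
def weilClass {k : Type u} [Field k] {W : Type u} [Group W] [TopologicalSpace W]
    [IsTopologicalGroup W] (φ : W →* Gal(AlgebraicClosure k/k)) (E : FinExt k) :
    weilSubgroup φ E →* TopologicalAbelianization (weilSubgroup φ E) :=
  QuotientGroup.mk' _

/-- The transfer homomorphism `W_E → W_{E'}^{ab}` for `E ⊆ E'`. -/
noncomputable def weilTransfer {k : Type u} [Field k] {W : Type u} [Group W] [TopologicalSpace W]
    [IsTopologicalGroup W] (φ : W →* Gal(AlgebraicClosure k/k)) (E E' : FinExt k) :
    weilSubgroup φ E →* TopologicalAbelianization (weilSubgroup φ E') :=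
  MonoidHom.transfer (H := (weilSubgroup φ E').subgroupOf (weilSubgroup φ E))
    ((weilClass φ E').comp
      (((weilSubgroup φ E).subtype.comp (Subgroup.subtype _)).codRestrict (weilSubgroup φ E')
        fun x => x.2))

/-- A Weil group of `k`, in the sense of Artin-Tate and Tate. -/
structure WeilGroup {k : Type u} [Field k] (𝒞 : ClassFieldData k) where
  W : Type u
  [group : Group W]
  [top : TopologicalSpace W]
  [isTopologicalGroup : IsTopologicalGroup W]
  φ : W →* Gal(AlgebraicClosure k/k)
  continuous_φ : Continuous φ
  denseRange_φ : DenseRange φ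
  /-- the isomorphisms of topological groups `C_E ≅ W_E^{ab}` -/
  r : ∀ E : FinExt k, 𝒞.C E ≃ₜ* TopologicalAbelianization (weilSubgroup φ E)
  /-- the composite `C_E → W_E^{ab} → Gal(k̄/E)^{ab}` is the reciprocity law -/
  reciprocity : ∀ E : FinExt k, 𝒞.IsReciprocity E fun a σ =>
    ∃ x : weilSubgroup φ E, weilClass φ E x = r E a ∧ φ x = σ
  /-- for `w ∈ W` with image `σ`, conjugation by `w` on Weil groups corresponds to
  `σ : C_E → C_{σE}` -/
  conj : ∀ {E E' : FinExt k} (τ : E.field →ₐ[k] E'.field) (w : W), Function.Surjective τ →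
    (∀ e : E.field, (τ e : AlgebraicClosure k) = φ w e) →
    ∀ (a : 𝒞.C E) (a' : 𝒞.C E'), 𝒞.IsImage τ a a' →
    ∀ (x : weilSubgroup φ E) (x' : weilSubgroup φ E'), (x' : W) = w * x * w⁻¹ →
      weilClass φ E x = r E a → weilClass φ E' x' = r E' a'
  /-- for `E ⊆ E'` the map `C_E → C_{E'}` corresponds to the transfer -/
  transfer : ∀ {E E' : FinExt k} (h : E.field ≤ E'.field) (a : 𝒞.C E) (a' : 𝒞.C E'),
    𝒞.IsImage (IntermediateField.inclusion h) a a' →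
    ∀ x : weilSubgroup φ E, weilClass φ E x = r E a → weilTransfer φ E E' x = r E' a'
  /-- `W` is the projective limit of the `W / W_E^c`, where `W_E^c` is the closure of the
  commutator subgroup of `W_E`; this has three parts: the topology, injectivity, surjectivity -/
  isInducing : Topology.IsInducing fun (x : W) (E : FinExt k) =>
    (QuotientGroup.mk x : W ⧸ ((weilClass φ E).ker.map (weilSubgroup φ E).subtype))
  separated : ∀ x : W, (∀ E, x ∈ (weilClass φ E).ker.map (weilSubgroup φ E).subtype) → x = 1
  complete : ∀ g : FinExt k → W,
    (∀ E E' : FinExt k, E.field ≤ E'.field →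
      (g E)⁻¹ * g E' ∈ (weilClass φ E).ker.map (weilSubgroup φ E).subtype) →
    ∃ x : W, ∀ E, (g E)⁻¹ * x ∈ (weilClass φ E).ker.map (weilSubgroup φ E).subtype

attribute [instance] WeilGroup.group WeilGroup.top WeilGroup.isTopologicalGroup

/-- The data for a local field `k` with ring of integers `O` (put `O = k` if `k` is archimedean):
`C_E = Eˣ`, and the reciprocity law is characterized by: if `k` is non-archimedean, uniformizers of
`E` act as the arithmetic Frobenius on the residue field of `k̄`; for every finite abelian extension
`L` of `E` in `k̄`, norms from `L` act trivially on `L`. If `k` is archimedean, the first condition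
is void since `O_E = E` has no irreducible elements. The field `E` carries its canonical topology as
a finite-dimensional vector space over `k`. -/
noncomputable def localData (k : Type u) [Field k] [TopologicalSpace k] (O : Subring k) :
    ClassFieldData k where
  C E := E.fieldˣ
  top E := letI : TopologicalSpace E.field := moduleTopology k E.field
    inferInstance
  IsImage τ a a' := (a' : _) = Units.map (τ : _ →* _) a
  IsReciprocity E ψ :=
    (∀ (p : integralClosure O E.field) (a : E.fieldˣ) (σ : Gal(AlgebraicClosure k/k)),
      Irreducible p → (a : E.field) = p → ψ a σ →
      ∀ Q : Ideal (integralClosure O (AlgebraicClosure k)), Q.IsMaximal →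
      ∀ x y : integralClosure O (AlgebraicClosure k), (y : AlgebraicClosure k) = σ x →
        y - x ^ Nat.card (integralClosure O E.field ⧸ Ideal.span {p}) ∈ Q) ∧
    ∀ L : IntermediateField E.field (AlgebraicClosure k),
      FiniteDimensional E.field L → IsAbelianGalois E.field L →
      ∀ (b : Lˣ) (σ : Gal(AlgebraicClosure k/k)), ψ (Units.map (Algebra.norm E.field) b) σ →
      ∀ x : L, σ x = x

/-- The data for a number field `F`: `C_E` is the idele class group, and the reciprocity law is
characterized by: for every finite abelian extension `L` of `E` in `F̄` and every finite place `w` of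
`E` unramified in `L`, the idele that is a uniformizer at `w` and `1` elsewhere acts on `L` as the
arithmetic Frobenius at `w`. -/
noncomputable def globalData (F : Type u) [Field F] [NumberField F] : ClassFieldData F where
  C E := IdeleClasses E.field
  IsImage τ a a' := ∃ x x', (QuotientGroup.mk x : IdeleClasses _) = a ∧
    (QuotientGroup.mk x' : IdeleClasses _) = a' ∧ Ideles.IsImage (τ : _ →+* _) x x'
  IsReciprocity E ψ :=
    ∀ (w : HeightOneSpectrum (𝓞 E.field)) (L : IntermediateField E.field (AlgebraicClosure F)),
      FiniteDimensional E.field L → IsAbelianGalois E.field L →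
      (∀ Q : Ideal (𝓞 L), Q.IsPrime → Q.LiesOver w.asIdeal →
        Q.ramificationIdx (𝓞 E.field) = 1) →
      ∀ (p : (w.adicCompletion E.field)ˣ) (x : Ideles E.field) (σ : Gal(AlgebraicClosure F/F)),
        Valued.v (p : w.adicCompletion E.field) = WithZero.exp (-1 : ℤ) →
        Ideles.IsSingle (Place.finite w) p x →
        ψ (QuotientGroup.mk x) σ →
        ∀ Q : Ideal (𝓞 L), Q.IsPrime → Q.LiesOver w.asIdeal →
        ∀ y z : 𝓞 L, ((z : L) : AlgebraicClosure F) = σ (y : L) →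
          z - y ^ Nat.card (𝓞 E.field ⧸ w.asIdeal) ∈ Q

variable {F : Type u} [Field F] [NumberField F]

/-- A global Weil group `W_F`. -/
abbrev GlobalWeilGroup (F : Type u) [Field F] [NumberField F] := WeilGroup (globalData F)

/-- A local Weil group `W_{F_v}`. -/
abbrev LocalWeilGroup (v : Place F) := WeilGroup (localData v.Completion v.integers)

/-- The map `π_v : W_{F_v} → W_{F_v}^{ab} ≅ F_vˣ → W_{κ(v)}`. -/
noncomputable def LocalWeilGroup.toResidue {v : Place F} (Wv : LocalWeilGroup v) :
    Wv.W →* v.ResidueGroup :=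
  v.valuation.comp <|
    (FinExt.baseUnits v.Completion).comp <|
    (MulEquiv.toMonoidHom (Wv.r (FinExt.base v.Completion)).symm.toMulEquiv).comp <|
    (weilClass Wv.φ (FinExt.base v.Completion)).comp <|
    (MonoidHom.id Wv.W).codRestrict (weilSubgroup Wv.φ (FinExt.base v.Completion)) fun x => by
      simp [weilSubgroup, FinExt.base]

/-- `θ : W_{F_v} → W_F` is a Weil map: it is continuous and there is an embedding `ι` of `F̄` into
`F̄_v` over `F` (i.e. a valuation of `F̄` over `v`) such that `θ` is compatible with the restriction
map `Gal(F̄_v/F_v) → Gal(F̄/F)` along `ι` and, for every finite extension `E` of `F`, with the map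
`E_vˣ → C_E` that sends `a` to the class of the idele with component `a` at the place `w` of `E`
induced by `ι` and `1` elsewhere. Here `E_v = F_v · ι(E)` is identified with the completion of `E`
at `w` through the topological isomorphism `c` that extends `ι`. -/
structure IsWeilMap (W : GlobalWeilGroup F) {v : Place F} (Wv : LocalWeilGroup v)
    (θ : Wv.W →* W.W) : Prop where
  continuous : Continuous θ
  compatible : ∃ ι : AlgebraicClosure F →ₐ[F] AlgebraicClosure v.Completion,
    (∀ (g : Wv.W) (x : AlgebraicClosure F), ι (W.φ (θ g) x) = Wv.φ g (ι x)) ∧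
    ∀ E : FinExt F, ∃ (Ev : FinExt v.Completion) (w : Place E.field)
      (c : w.Completion ≃+* Ev.field),
      Ev.field = IntermediateField.adjoin v.Completion (ι '' (E.field : Set (AlgebraicClosure F))) ∧
      @IsHomeomorph _ _ inferInstance (moduleTopology v.Completion Ev.field) c ∧
      (∀ e : E.field, (c (algebraMap E.field w.Completion e) : AlgebraicClosure v.Completion) =
        ι e) ∧
      ∀ (a : w.Completionˣ) (x : Ideles E.field), Ideles.IsSingle w a x →
      ∀ (g : weilSubgroup Wv.φ Ev) (h : weilSubgroup W.φ E), (h : W.W) = θ g →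
        weilClass Wv.φ Ev g = Wv.r Ev (Units.map (c : _ →* Ev.field) a) →
        weilClass W.φ E h = W.r E (QuotientGroup.mk x)

/-- The group `U_{K,S}` of ideles of `K` which are `1` at the places over `S` and units at the other
places. A unit at an archimedean place is an element of absolute value `1`. -/
def unitIdeles (K : FinExt F) (S : Finset (Place F)) : Set (Ideles K.field) :=
  {x | ∀ w : Place K.field,
    (w.under F ∈ S → Ideles.component w x = 1) ∧
    (w.under F ∉ S → w.valuation (Ideles.component w x) = 1)}

/-- The kernel `N_{K,S}` of `W_F → W_{K/F,S}`: the preimage in `W_K` of the image of `U_{K,S}` in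
`C_K ≅ W_K^{ab}`. If `K/F` is Galois this preimage is already a normal subgroup of `W_F`; taking the
normal closure changes nothing and only makes normality available. -/
def weilKernel (W : GlobalWeilGroup F) (K : FinExt F) (S : Finset (Place F)) : Subgroup W.W :=
  Subgroup.normalClosure {g | ∃ h : weilSubgroup W.φ K, (h : W.W) = g ∧
    ∃ x ∈ unitIdeles K S, weilClass W.φ K h = W.r K (QuotientGroup.mk x)}

instance (W : GlobalWeilGroup F) (K : FinExt F) (S : Finset (Place F)) :
    (weilKernel W K S).Normal :=
  Subgroup.normalClosure_normal

/-- The `S`-Weil group `W_{K/F,S}`. -/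
abbrev SWeilGroup (W : GlobalWeilGroup F) (K : FinExt F) (S : Finset (Place F)) : Type u :=
  W.W ⧸ weilKernel W K S

/-- The groups that define the category `T_{K,S,Ȳ}`: the group `W_{K/F,S}` at the trivial valuation
`v₀`, the groups `W_{κ(v)}` at the non-trivial valuations `v`, and the local Weil groups `W_{F_v}`,
which map to the former through the Weil map `θ_v` and to the latter through `π_v`. -/
def weilDiagram (W : GlobalWeilGroup F) (Wl : ∀ v : Place F, LocalWeilGroup v)
    (θ : ∀ v, (Wl v).W →* W.W) (K : FinExt F) (S : Finset (Place F)) :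
    GroupDiagram.{u} (Place F) where
  generic := SWeilGroup W K S
  special v := v.ResidueGroup
  loc v := (Wl v).W
  toSpecial v := (Wl v).toResidue
  toGeneric v := (QuotientGroup.mk' (weilKernel W K S)).comp (θ v)

/-- The sheaf `Ã` on `T_{W_{K/F,S}}` of a topological `W_F`-module `A`: the sections over a
`W_{K/F,S}`-space `X` are the continuous `W_F`-equivariant maps `X → A`. They take values in the
submodule `A_{K,S}` of `N_{K,S}`-invariants. -/
def tildeSheaf (W : GlobalWeilGroup F) (Wl : ∀ v : Place F, LocalWeilGroup v)
    (θ : ∀ v, (Wl v).W →* W.W) (K : FinExt F) (S : Finset (Place F))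
    (A : Type u) [AddCommGroup A] [TopologicalSpace A] [IsTopologicalAddGroup A]
    [DistribMulAction W.W A] :
    Sheaf (GSpace.localSectionTopology.{u, u} (weilDiagram W Wl θ K S).generic)
      AddCommGrpCat.{u + 1} :=
  GSpace.tilde (QuotientGroup.mk' (weilKernel W K S)) A

end WeilGroups

end WeilEtale

open WeilEtale

/-!
The theorem has a part that holds for every diagram of groups `special v ← loc v → generic` and a
part that uses class field theory.

Say that a sheaf `B` on the site of a diagram is supported on a set `S` of indices if every section
dies on a sieve that covers in the generic component and in all components outside of `S`
(`IsSupportedOn`). Such a `B` vanishes on objects that are empty at all `v ∈ S`, and hence is a sheaf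
for the much finer topology `topologyOn S`, in which only the components at `v ∈ S` have to be covered
(`IsSupportedOn.isSheaf`). So `B(𝒳)` is the product over `v ∈ S` of the values of `B` on the parts of
`𝒳` at `v`, and there the generic component can be replaced by a point. This makes `B` the product of
the direct images of sheaves on the sites of `special v`-spaces; each factor is universal among the
maps from `B` to direct images from `v`, so it is `(i_v)_* i_v^* B`, for formal reasons
(`isIso_toProd`). No exactness property of `i_v^*` is needed.

For `q > 0` a section of `R^q j_*` is locally represented by a cocycle of sections of an injective
resolution over the generic component, and it dies when the cocycle becomes a coboundary on some
covering `U → X_{v₀}`. If the homomorphism `loc v → generic` factors through a continuous homomorphism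
`special v → generic`, such a covering can be refined to a map of objects that also covers at `v`: over
an open `Z ⊆ X_v` on which `U` has a section take `special v × Z`, with generic component
`generic × Z`. Hence `R^q j_*` is supported on the indices where there is no such factorization
(`isSupportedOn_genHigherDirectImage`).

It remains to show that for `v ∉ S` the Weil map `W_{F_v} → W_F → W_{K/F,S}` factors through the
residue map, that is, that `θ_v` maps an element `g` with trivial residue into `N_{K,S}`
(`IsWeilMap.apply_mem_weilKernel`).
* `g` acts trivially on `K`. At a finite place its class in `F_vˣ` is a quotient of two uniformizers,
  which both act as the Frobenius on the residue field of the algebraic closure; so `g` acts through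
  an inertia group of `K/F`, and this is trivial since `v` is unramified
  (`mem_fixingSubgroup_of_unramified`). At an archimedean place `E_v = F_v`
  (`algebraMap_surjective_of_isUnramified`).
* Thus `g` has a class `a` in `E_vˣ`, where `E_v = F_v · ι(K)`. The compatibility of the reciprocity
  isomorphisms with the transfer and with conjugation exhibits the class `b ∈ F_vˣ` of `g` as a product
  of conjugates of `a` (`exists_prod_conjugates_eq`). Being a unit can be expressed by topological
  nilpotence, which conjugations preserve; so `a` is a unit because `b` is one.
* By the compatibility of `θ_v` with the reciprocity isomorphisms, `θ_v(g)` has the class of the idele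
  with the single component `a`, and this idele lies in `U_{K,S}`.
-/

namespace WeilEtale

namespace GroupDiagram

variable {I : Type u} {D : GroupDiagram.{u} I}

/-! ### Partial covering conditions on the site of a group diagram -/

/-- The map into the componentwise fibre product given by two maps that agree on the base. -/
def Obj.fiberLift {X Y Z T : Obj D} {a : X ⟶ Z} {b : Y ⟶ Z} (p : T ⟶ X) (q : T ⟶ Y)
    (h : p ≫ a = q ≫ b) : T ⟶ Obj.fiber a b where
  gen := GSpace.fiberLift (Hom.gen p) (Hom.gen q) (congrArg Hom.gen h)
  sp v := GSpace.fiberLift (Hom.sp p v) (Hom.sp q v) (congrFun (congrArg Hom.sp h) v)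
  comm v x := Subtype.ext (Prod.ext (Hom.comm p v x) (Hom.comm q v x))

/-- The sieve `R` on `𝒳` is covering in the component `v`. -/
def CoversAt (v : I) {X : Obj D} (R : Sieve X) : Prop :=
  ∀ x : X.sp v, ∃ (Y : Obj D) (g : Y ⟶ X), R g ∧
    ∃ V : Set (X.sp v), IsOpen V ∧ x ∈ V ∧ ∃ s : C(V, Y.sp v),
      ∀ y : V, GSpace.Hom.map (Obj.Hom.sp g v) (s y) = y

/-- The sieve `R` on `𝒳` is covering in the generic component. -/
def CoversGen {X : Obj D} (R : Sieve X) : Prop :=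
  ∀ x : X.gen, ∃ (Y : Obj D) (g : Y ⟶ X), R g ∧
    ∃ V : Set X.gen, IsOpen V ∧ x ∈ V ∧ ∃ s : C(V, Y.gen),
      ∀ y : V, GSpace.Hom.map (Obj.Hom.gen g) (s y) = y

theorem functorPushforward_sp_mem_iff (v : I) {X : Obj D} (R : Sieve X) :
    R.functorPushforward (D.spFunctor v) ∈ GSpace.localSectionTopology _ ((D.spFunctor v).obj X) ↔
      CoversAt v R := by
  constructor
  · intro h x
    obtain ⟨T, t, ⟨Z, r, k, hr, rfl⟩, V, hV, hx, s, hs⟩ := h x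
    exact ⟨Z, r, hr, V, hV, hx, (GSpace.Hom.map k).comp s, fun y => hs y⟩
  · intro h x
    obtain ⟨Y, g, hg, V, hV, hx, s, hs⟩ := h x
    exact ⟨Y.sp v, Obj.Hom.sp g v, ⟨Y, g, 𝟙 _, hg, (Category.id_comp _).symm⟩, V, hV, hx, s, hs⟩

theorem functorPushforward_gen_mem_iff {X : Obj D} (R : Sieve X) :
    R.functorPushforward (D.genFunctor) ∈ GSpace.localSectionTopology _ (D.genFunctor.obj X) ↔
      CoversGen R := by
  constructor
  · intro h x
    obtain ⟨T, t, ⟨Z, r, k, hr, rfl⟩, V, hV, hx, s, hs⟩ := h x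
    exact ⟨Z, r, hr, V, hV, hx, (GSpace.Hom.map k).comp s, fun y => hs y⟩
  · intro h x
    obtain ⟨Y, g, hg, V, hV, hx, s, hs⟩ := h x
    exact ⟨Y.gen, Obj.Hom.gen g, ⟨Y, g, 𝟙 _, hg, (Category.id_comp _).symm⟩, V, hV, hx, s, hs⟩

theorem mem_topology_iff {X : Obj D} (R : Sieve X) :
    R ∈ D.topology X ↔ CoversGen R ∧ ∀ v, CoversAt v R :=
  and_congr (functorPushforward_gen_mem_iff R)
    (forall_congr' fun v => functorPushforward_sp_mem_iff v R)

theorem CoversAt.mono {v : I} {X : Obj D} {R T : Sieve X} (h : R ≤ T) (hR : CoversAt v R) :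
    CoversAt v T := fun x => by
  obtain ⟨Y, g, hg, hh⟩ := hR x
  exact ⟨Y, g, h _ hg, hh⟩

theorem CoversGen.mono {X : Obj D} {R T : Sieve X} (h : R ≤ T) (hR : CoversGen R) :
    CoversGen T := fun x => by
  obtain ⟨Y, g, hg, hh⟩ := hR x
  exact ⟨Y, g, h _ hg, hh⟩

theorem CoversAt.of_isEmpty {v : I} {X : Obj D} (h : IsEmpty (X.sp v)) (R : Sieve X) :
    CoversAt v R := fun x => isEmptyElim x

theorem CoversAt.of_section {v : I} {X Y : Obj D} {R : Sieve X} (g : Y ⟶ X) (hg : R g)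
    (s : C(X.sp v, Y.sp v)) (hs : ∀ x, GSpace.Hom.map (Obj.Hom.sp g v) (s x) = x) :
    CoversAt v R := fun _ =>
  ⟨Y, g, hg, Set.univ, isOpen_univ, trivial, s.comp ⟨Subtype.val, continuous_subtype_val⟩,
    fun y => hs y⟩

theorem CoversAt.pullback {v : I} {X Y : Obj D} {R : Sieve X} (hR : CoversAt v R) (a : Y ⟶ X) :
    CoversAt v (R.pullback a) := fun y => by
  obtain ⟨Z, g, hg, V, hV, hyV, s, hs⟩ := hR (GSpace.Hom.map (Obj.Hom.sp a v) y)
  refine ⟨Obj.fiber g a, Obj.fiberSnd g a, ?_, GSpace.Hom.map (Obj.Hom.sp a v) ⁻¹' V,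
    hV.preimage (map_continuous _), hyV,
    ⟨fun t => ⟨(s ⟨GSpace.Hom.map (Obj.Hom.sp a v) t, t.2⟩, t), hs ⟨_, t.2⟩⟩, ?_⟩, fun _ => rfl⟩
  · change R (Obj.fiberSnd g a ≫ a)
    rw [← Obj.fiber_condition]
    exact R.downward_closed hg _
  · refine Continuous.subtype_mk (Continuous.prodMk ?_ continuous_subtype_val) _
    exact s.continuous.comp (Continuous.subtype_mk
      ((map_continuous (GSpace.Hom.map (Obj.Hom.sp a v))).comp continuous_subtype_val) _)

theorem CoversAt.transitive {v : I} {X : Obj D} {R T : Sieve X} (hR : CoversAt v R)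
    (hT : ∀ ⦃Y : Obj D⦄ ⦃f : Y ⟶ X⦄, R f → CoversAt v (T.pullback f)) : CoversAt v T := by
  rw [← functorPushforward_sp_mem_iff] at hR ⊢
  refine GrothendieckTopology.transitive _ hR _ ?_
  rintro Y g ⟨Z, r, h, hr, rfl⟩
  rw [Sieve.pullback_comp]
  refine GrothendieckTopology.pullback_stable _ h ?_
  refine GrothendieckTopology.superset_covering _ ?_
    ((functorPushforward_sp_mem_iff v _).2 (hT hr))
  rintro Y' g' ⟨Z', r', h', hr', rfl⟩
  exact ⟨Z', r' ≫ r, h', hr', by simp⟩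

theorem CoversGen.transitive {X : Obj D} {R T : Sieve X} (hR : CoversGen R)
    (hT : ∀ ⦃Y : Obj D⦄ ⦃f : Y ⟶ X⦄, R f → CoversGen (T.pullback f)) : CoversGen T := by
  rw [← functorPushforward_gen_mem_iff] at hR ⊢
  refine GrothendieckTopology.transitive _ hR _ ?_
  rintro Y g ⟨Z, r, h, hr, rfl⟩
  rw [Sieve.pullback_comp]
  refine GrothendieckTopology.pullback_stable _ h ?_
  refine GrothendieckTopology.superset_covering _ ?_
    ((functorPushforward_gen_mem_iff _).2 (hT hr))
  rintro Y' g' ⟨Z', r', h', hr', rfl⟩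
  exact ⟨Z', r' ≫ r, h', hr', by simp⟩

variable (D) in
/-- The topology on the category of objects of the site in which a sieve is covering if it is
covering in the components `v ∈ S`; its sheaves are those supported on the components in `S`. -/
def topologyOn (S : Set I) : GrothendieckTopology (Obj D) where
  sieves _ := {R | ∀ v ∈ S, CoversAt v R}
  top_mem' X _ _ := CoversAt.of_section (𝟙 X) trivial (ContinuousMap.id _) fun _ => rfl
  pullback_stable' _ _ _ a hR v hv := (hR v hv).pullback a
  transitive' _ _ hR _ hT v hv := (hR v hv).transitive fun _ _ hf => hT hf v hv

/-! ### Objects with prescribed components -/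

/-- The part of `𝒳` that has the same generic component, the same components in `T` and the empty
space as component at all other indices. -/
def Obj.restrict (T : Set I) (X : Obj D) : Obj D where
  gen := X.gen
  sp v :=
    letI : MulAction (D.special v) {_x : X.sp v // v ∈ T} :=
      { smul := fun g x => ⟨g • x.1, x.2⟩
        one_smul := fun x => Subtype.ext (one_smul _ x.1)
        mul_smul := fun a b x => Subtype.ext (mul_smul a b x.1) }
    haveI : ContinuousSMul (D.special v) {_x : X.sp v // v ∈ T} :=
      ⟨Continuous.subtype_mk
        (continuous_fst.smul (continuous_subtype_val.comp continuous_snd)) _⟩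
    ⟨{_x : X.sp v // v ∈ T}⟩
  f v := (X.f v).comp ⟨Subtype.val, continuous_subtype_val⟩
  f_smul v g x := X.f_smul v g x.1

/-- The inclusion of the part of `𝒳` with components in `T`. -/
def Obj.restrictι (T : Set I) (X : Obj D) : X.restrict T ⟶ X where
  gen := 𝟙 _
  sp _ := ⟨⟨Subtype.val, continuous_subtype_val⟩, fun _ _ => rfl⟩
  comm _ _ := rfl

/-- Restriction to the components in `T` is functorial. -/
def Obj.restrictMap (T : Set I) {X Y : Obj D} (a : X ⟶ Y) : X.restrict T ⟶ Y.restrict T where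
  gen := Hom.gen (X := X) (Y := Y) a
  sp v := ⟨⟨fun x => ⟨GSpace.Hom.map (Hom.sp a v) x.1, x.2⟩,
    Continuous.subtype_mk ((map_continuous _).comp continuous_subtype_val) _⟩,
    fun g x => Subtype.ext (GSpace.Hom.map_smul (Hom.sp a v) g x.1)⟩
  comm v x := Hom.comm a v x.1

theorem Obj.restrictMap_ι (T : Set I) {X Y : Obj D} (a : X ⟶ Y) :
    restrictMap T a ≫ restrictι T Y = restrictι T X ≫ a := rfl

theorem Obj.isEmpty_restrict (T : Set I) (X : Obj D) {v : I} (hv : v ∉ T) :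
    IsEmpty ((X.restrict T).sp v) := ⟨fun x => hv x.2⟩

theorem Obj.isEmpty_of_hom {X Y : Obj D} (f : X ⟶ Y) {v : I} (h : IsEmpty (Y.sp v)) :
    IsEmpty (X.sp v) := ⟨fun x => h.false (GSpace.Hom.map (Hom.sp f v) x)⟩

variable (D) in
/-- The homomorphism `special w → special v` given by an equality `w = v`. -/
def castSpecial {w v : I} (h : w = v) : D.special w →* D.special v := by
  subst h; exact MonoidHom.id _

theorem continuous_castSpecial {w v : I} (h : w = v) : Continuous (D.castSpecial h) := by
  subst h; exact continuous_id

/-- The object with a one-point generic component, with the component `X` at `v`, and with all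
other components empty. -/
def Obj.skyscraper (v : I) (X : GSpace.{0, u} (D.special v)) : Obj D where
  gen :=
    letI : MulAction D.generic PUnit.{u + 1} :=
      { smul := fun _ x => x, one_smul := fun _ => rfl, mul_smul := fun _ _ _ => rfl }
    haveI : ContinuousSMul D.generic PUnit.{u + 1} := ⟨continuous_const⟩
    ⟨PUnit.{u + 1}⟩
  sp w :=
    letI : MulAction (D.special w) {_x : X // w = v} :=
      { smul := fun g x => ⟨D.castSpecial x.2 g • x.1, x.2⟩
        one_smul := fun x => Subtype.ext (by
          change D.castSpecial x.2 1 • x.1 = x.1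
          rw [map_one, one_smul])
        mul_smul := fun a b x => Subtype.ext (by
          change D.castSpecial x.2 (a * b) • x.1 = D.castSpecial x.2 a • D.castSpecial x.2 b • x.1
          rw [map_mul, mul_smul]) }
    haveI : ContinuousSMul (D.special w) {_x : X // w = v} := ⟨by
      by_cases h : w = v
      · exact Continuous.subtype_mk (((continuous_castSpecial h).comp continuous_fst).smul
          (continuous_subtype_val.comp continuous_snd)) _
      · have : IsEmpty (D.special w × {_x : X // w = v}) := ⟨fun x => h x.2.2⟩
        exact continuous_of_const fun x => isEmptyElim x⟩
    ⟨{_x : X // w = v}⟩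
  f w := ⟨fun _ => PUnit.unit, continuous_const⟩
  f_smul _ _ _ := rfl

variable (D) in
/-- The formation of the object concentrated at `v` is functorial. -/
def skyscraperFunctor (v : I) : GSpace.{0, u} (D.special v) ⥤ Obj D where
  obj X := Obj.skyscraper v X
  map a :=
    { gen := 𝟙 _
      sp := fun _ => ⟨⟨fun x => ⟨GSpace.Hom.map a x.1, x.2⟩,
        Continuous.subtype_mk ((map_continuous _).comp continuous_subtype_val) _⟩,
        fun g x => Subtype.ext (GSpace.Hom.map_smul a (D.castSpecial x.2 g) x.1)⟩
      comm := fun _ _ => rfl }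
  map_id _ := rfl
  map_comp _ _ := rfl

theorem isEmpty_skyscraper {v w : I} (h : w ≠ v) (X : GSpace.{0, u} (D.special v)) :
    IsEmpty (((D.skyscraperFunctor v).obj X).sp w) := ⟨fun x => h x.2⟩

/-- The component at `v` of the object concentrated at `v`. -/
def toSkyscraperSp (v : I) (X : GSpace.{0, u} (D.special v)) :
    X ⟶ (D.spFunctor v).obj ((D.skyscraperFunctor v).obj X) :=
  ⟨⟨fun x => ⟨x, rfl⟩, Continuous.subtype_mk continuous_id _⟩, fun _ _ => rfl⟩

/-- The inverse of `toSkyscraperSp`. -/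
def ofSkyscraperSp (v : I) (X : GSpace.{0, u} (D.special v)) :
    (D.spFunctor v).obj ((D.skyscraperFunctor v).obj X) ⟶ X :=
  ⟨⟨Subtype.val, continuous_subtype_val⟩, fun _ _ => rfl⟩

theorem toSkyscraperSp_of (v : I) (X : GSpace.{0, u} (D.special v)) :
    toSkyscraperSp v X ≫ ofSkyscraperSp v X = 𝟙 X := rfl

/-- The part of `𝒳` at `v` maps to the object concentrated at `v` with component `X_v`. -/
def Obj.restrictToSkyscraper (v : I) (X : Obj D) :
    X.restrict {v} ⟶ (D.skyscraperFunctor v).obj ((D.spFunctor v).obj X) where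
  gen := ⟨⟨fun _ => PUnit.unit, continuous_const⟩, fun _ _ => rfl⟩
  sp w := by
    refine ⟨⟨fun x => ⟨(x.2 : w = v) ▸ x.1, x.2⟩, ?_⟩, ?_⟩
    · by_cases h : w = v
      · subst h
        exact Continuous.subtype_mk continuous_subtype_val _
      · have : IsEmpty ((X.restrict {v}).sp w) := Obj.isEmpty_restrict _ _ h
        exact continuous_of_const fun x => isEmptyElim x
    · rintro g ⟨x, hx⟩
      obtain rfl : w = v := hx
      rfl
  comm _ _ := rfl

theorem Obj.restrictToSkyscraper_naturality (v : I) {X Y : Obj D} (a : X ⟶ Y) :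
    restrictMap {v} a ≫ Y.restrictToSkyscraper v =
      X.restrictToSkyscraper v ≫ (D.skyscraperFunctor v).map ((D.spFunctor v).map a) := by
  refine Hom.ext rfl (funext fun w => GSpace.hom_ext ?_)
  rintro ⟨x, hx⟩
  obtain rfl : w = v := hx
  rfl

end GroupDiagram

namespace GroupDiagram

variable {I : Type u} {D : GroupDiagram.{u} I}

/-! ### Sheaves supported on a set of components -/

/-- The sheaf `B` is supported on the components in `S`: every section dies on a sieve that covers
the generic component and all components outside of `S`. -/
def IsSupportedOn (B : Sheaf D.topology AddCommGrpCat.{u + 1}) (S : Set I) : Prop :=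
  ∀ (X : Obj D) (b : B.obj.obj (op X)), ∃ R : Sieve X, CoversGen R ∧ (∀ v ∉ S, CoversAt v R) ∧
    ∀ ⦃Y : Obj D⦄ (f : Y ⟶ X), R f → B.obj.map f.op b = 0

theorem isSheaf_forget {C : Type (u + 1)} [Category.{u} C] {J : GrothendieckTopology C}
    (B : Sheaf J AddCommGrpCat.{u + 1}) :
    Presieve.IsSheaf J (B.obj ⋙ forget AddCommGrpCat.{u + 1}) := by
  rw [← isSheaf_iff_isSheaf_of_type]
  exact (Presheaf.isSheaf_iff_isSheaf_forget _ _ (forget AddCommGrpCat.{u + 1})).1 B.property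

theorem eq_zero_of_covering {C : Type (u + 1)} [Category.{u} C] {J : GrothendieckTopology C}
    (B : Sheaf J AddCommGrpCat.{u + 1}) {X : C} {R : Sieve X} (hR : R ∈ J X)
    (b : B.obj.obj (op X)) (hb : ∀ ⦃Y : C⦄ (f : Y ⟶ X), R f → B.obj.map f.op b = 0) : b = 0 := by
  refine ((isSheaf_forget B) R hR).isSeparatedFor.ext (t₁ := b) (t₂ := (0 : B.obj.obj (op X))) ?_
  intro Y f hf
  change B.obj.map f.op b = B.obj.map f.op 0
  rw [hb f hf, map_zero]

variable {B : Sheaf D.topology AddCommGrpCat.{u + 1}} {S : Set I}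

theorem map_op_comp {C : Type (u + 1)} [Category.{u} C] (B : Cᵒᵖ ⥤ AddCommGrpCat.{u + 1})
    {X Y Z : C} (f : X ⟶ Y) (g : Y ⟶ Z) (b : B.obj (op Z)) :
    B.map f.op (B.map g.op b) = B.map (f ≫ g).op b := by
  rw [op_comp, B.map_comp]; rfl

/-- A sheaf supported on the components in `S` vanishes on objects that are empty there: the sieve on
which a section dies is then covering. -/
theorem IsSupportedOn.eq_zero_of_isEmpty (hB : IsSupportedOn B S) {X : Obj D}
    (hX : ∀ v ∈ S, IsEmpty (X.sp v)) (b : B.obj.obj (op X)) : b = 0 := by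
  obtain ⟨R, h1, h2, h3⟩ := hB X b
  refine eq_zero_of_covering B ((mem_topology_iff R).2 ⟨h1, fun v => ?_⟩) b h3
  by_cases hv : v ∈ S
  · exact CoversAt.of_isEmpty (hX v hv) R
  · exact h2 v hv

/-- The sieve of all maps from objects whose components in `S` are empty. -/
def emptySieve (S : Set I) (X : Obj D) : Sieve X where
  arrows Y _ := ∀ v ∈ S, IsEmpty (Y.sp v)
  downward_closed h g v hv := Obj.isEmpty_of_hom g (h v hv)

theorem coversGen_emptySieve (S : Set I) (X : Obj D) : CoversGen (emptySieve S X) := fun _ =>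
  ⟨X.restrict ∅, X.restrictι ∅, fun _ _ => X.isEmpty_restrict ∅ (Set.notMem_empty _), Set.univ,
    isOpen_univ, trivial, ⟨Subtype.val, continuous_subtype_val⟩, fun _ => rfl⟩

theorem coversAt_emptySieve {S : Set I} (X : Obj D) {v : I} (hv : v ∉ S) :
    CoversAt v (emptySieve S X) :=
  CoversAt.of_section (X.restrictι {v})
    (fun w hw => X.isEmpty_restrict {v} fun h => hv (by rwa [← Set.mem_singleton_iff.1 h]))
    ⟨fun x => ⟨x, rfl⟩, Continuous.subtype_mk continuous_id _⟩ fun _ => rfl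

theorem sup_emptySieve_mem {X : Obj D} {R : Sieve X} (hR : R ∈ D.topologyOn S X) :
    R ⊔ emptySieve S X ∈ D.topology X := by
  refine (mem_topology_iff _).2 ⟨(coversGen_emptySieve S X).mono le_sup_right, fun v => ?_⟩
  by_cases hv : v ∈ S
  · exact (hR v hv).mono le_sup_left
  · exact (coversAt_emptySieve X hv).mono le_sup_right

/-- A sheaf supported on the components in `S` is a sheaf for the topology in which only these
components matter: a family on a sieve covering in these components extends by zero to a covering
sieve of the full site. -/
theorem IsSupportedOn.isSheaf (hB : IsSupportedOn B S) :
    Presheaf.IsSheaf (D.topologyOn S) B.obj := by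
  classical
  rw [Presheaf.isSheaf_iff_isSheaf_forget _ _ (forget AddCommGrpCat.{u + 1}),
    isSheaf_iff_isSheaf_of_type]
  intro X R hR x hx
  have hcov := sup_emptySieve_mem hR
  let y : Presieve.FamilyOfElements (B.obj ⋙ forget AddCommGrpCat.{u + 1})
      (R ⊔ emptySieve S X : Sieve X).arrows :=
    fun Y f _ => if h : R f then x f h else (0 : B.obj.obj (op Y))
  have hy : ∀ {Y : Obj D} (f : Y ⟶ X) (hf : (R ⊔ emptySieve S X : Sieve X) f) (h : R f),
      y f hf = x f h := fun f _ h => dif_pos h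
  have hcompat : y.Compatible := by
    rw [Presieve.compatible_iff_sieveCompatible] at hx ⊢
    intro Y Z f g hf
    by_cases h : R f
    · rw [hy f hf h, hy (g ≫ f) (Sieve.downward_closed _ hf g) (R.downward_closed h g), hx f g h]
    · have hf' : emptySieve S X f := hf.resolve_left h
      have hz : ∀ b c : B.obj.obj (op Z), b = c := fun b c =>
        (hB.eq_zero_of_isEmpty (fun v hv => Obj.isEmpty_of_hom g (hf' v hv)) b).trans
          (hB.eq_zero_of_isEmpty (fun v hv => Obj.isEmpty_of_hom g (hf' v hv)) c).symm
      exact hz _ _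
  obtain ⟨t, ht, -⟩ := isSheaf_forget B _ hcov y hcompat
  have hle : ∀ {Y : Obj D} (f : Y ⟶ X), R f → (R ⊔ emptySieve S X : Sieve X) f :=
    fun f h => Or.inl h
  refine ⟨t, fun Y f hf => (ht f (hle f hf)).trans (hy f (hle f hf) hf), fun t' ht' => ?_⟩
  refine (isSheaf_forget B _ hcov).isSeparatedFor.ext fun Y f hf => ?_
  rcases hf with hf | hf
  · exact (ht' f hf).trans ((ht f (hle f hf)).trans (hy f (hle f hf) hf)).symm
  · exact (hB.eq_zero_of_isEmpty hf _).trans (hB.eq_zero_of_isEmpty hf _).symm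

/-- Sheaves of abelian groups for the topology in which only the components in `S` matter. -/
abbrev SheafOn (D : GroupDiagram.{u} I) (S : Set I) := Sheaf (D.topologyOn S) AddCommGrpCat.{u + 1}

/-- A sheaf for `topologyOn S` takes a map that is an isomorphism in the components in `S` to a
bijection: it does not see the other components. -/
theorem bijective_map_of_sections (C : SheafOn D S) {X Y : Obj D} (f : Y ⟶ X)
    (s : ∀ v ∈ S, C(X.sp v, Y.sp v))
    (hs : ∀ v (hv : v ∈ S) x, GSpace.Hom.map (Obj.Hom.sp f v) (s v hv x) = x)
    (hinj : ∀ v ∈ S, Function.Injective (GSpace.Hom.map (Obj.Hom.sp f v))) :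
    Function.Bijective (C.obj.map f.op) := by
  have hf : Sieve.generate (Presieve.singleton f) ∈ D.topologyOn S X := fun v hv =>
    CoversAt.of_section f ⟨_, 𝟙 _, f, Presieve.singleton_self f, Category.id_comp _⟩ (s v hv) (hs v hv)
  have h1 := (Presieve.isSheafFor_iff_generate _).2 (isSheaf_forget C _ hf)
  rw [Presieve.isSheafFor_singleton] at h1
  -- The diagonal is covering, so that the two restrictions to the fibre product coincide.
  let δ : Y ⟶ Obj.fiber f f := Obj.fiberLift (𝟙 Y) (𝟙 Y) rfl
  have hδ : Sieve.generate (Presieve.singleton δ) ∈ D.topologyOn S (Obj.fiber f f) := fun v hv =>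
    CoversAt.of_section δ ⟨_, 𝟙 _, δ, Presieve.singleton_self δ, Category.id_comp _⟩
      ⟨fun p => p.1.1, continuous_fst.comp continuous_subtype_val⟩
      fun p => Subtype.ext (Prod.ext rfl (hinj v hv p.2))
  have h2 := ((Presieve.isSheafFor_iff_generate _).2 (isSheaf_forget C _ hδ)).isSeparatedFor
  have hpr : ∀ y : C.obj.obj (op Y), C.obj.map (Obj.fiberFst f f).op y =
      C.obj.map (Obj.fiberSnd f f).op y := by
    intro y
    refine h2.ext (t₁ := C.obj.map (Obj.fiberFst f f).op y)
      (t₂ := C.obj.map (Obj.fiberSnd f f).op y) fun Z g hg => ?_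
    obtain ⟨⟩ := hg
    change C.obj.map δ.op _ = C.obj.map δ.op _
    rw [map_op_comp, map_op_comp]
    rfl
  constructor
  · intro a b hab
    obtain ⟨c, -, hc⟩ := h1 (C.obj.map f.op a) (fun p q hpq => by
      change C.obj.map p.op _ = C.obj.map q.op _
      rw [map_op_comp, map_op_comp, hpq])
    exact (hc a rfl).trans (hc b hab.symm).symm
  · intro y
    obtain ⟨c, hc, -⟩ := h1 y (fun {Z} p q hpq => by
      change C.obj.map p.op y = C.obj.map q.op y
      have h3 := congrArg (C.obj.map (Obj.fiberLift p q hpq).op) (hpr y)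
      rw [map_op_comp, map_op_comp] at h3
      exact h3)
    exact ⟨c, hc⟩

/-- The sections of a sheaf for `topologyOn S` over `𝒳` are the families of sections over the parts
of `𝒳` at the `v ∈ S`. -/
theorem bijective_restrict (C : SheafOn D S) (X : Obj D) :
    Function.Bijective fun (b : C.obj.obj (op X)) (v : S) =>
      C.obj.map (X.restrictι {v.1}).op b := by
  let a : ∀ v : S, X.restrict {v.1} ⟶ X := fun v => X.restrictι {v.1}
  have ha : Sieve.generate (Presieve.ofArrows _ a) ∈ D.topologyOn S X := fun v hv =>
    CoversAt.of_section (a ⟨v, hv⟩)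
      ⟨_, 𝟙 _, a ⟨v, hv⟩, Presieve.ofArrows.mk (⟨v, hv⟩ : S), Category.id_comp _⟩
      ⟨fun x => ⟨x, rfl⟩, Continuous.subtype_mk continuous_id _⟩ fun _ => rfl
  have h1 := (Presieve.isSheafFor_iff_generate _).2 (isSheaf_forget C _ ha)
  rw [Presieve.isSheafFor_arrows_iff] at h1
  have hzero : ∀ Z : Obj D, (∀ v ∈ S, IsEmpty (Z.sp v)) → ∀ b c : C.obj.obj (op Z), b = c := by
    intro Z hZ b c
    have h : (⊥ : Sieve Z) ∈ D.topologyOn S Z := fun v hv => CoversAt.of_isEmpty (hZ v hv) _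
    exact (isSheaf_forget C _ h).isSeparatedFor.ext (t₁ := b) (t₂ := c) fun _ _ h => h.elim
  have hmono : ∀ (v : S) {Z : Obj D} (p q : Z ⟶ X.restrict {v.1}), p ≫ a v = q ≫ a v → p = q := by
    intro v Z p q h
    refine Obj.Hom.ext (congrArg (fun k : Z ⟶ X => Obj.Hom.gen k) h)
      (funext fun w => GSpace.hom_ext fun z => ?_)
    exact Subtype.ext (congrArg (fun k : Z ⟶ X => GSpace.Hom.map (Obj.Hom.sp k w) z) h)
  have key : ∀ x : (v : S) → C.obj.obj (op (X.restrict {v.1})),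
      Presieve.Arrows.Compatible (C.obj ⋙ forget AddCommGrpCat.{u + 1}) a x := by
    intro x v w Z p q h
    by_cases hvw : v = w
    · subst hvw
      rw [hmono v p q h]
    · refine hzero Z (fun t _ => ?_) _ _
      by_cases htv : t = v.1
      · exact Obj.isEmpty_of_hom q (X.isEmpty_restrict _ fun h' =>
          hvw (Subtype.ext (htv.symm.trans h')))
      · exact Obj.isEmpty_of_hom p (X.isEmpty_restrict _ htv)
  constructor
  · intro b c hbc
    obtain ⟨t, -, ht⟩ := h1 (fun v => C.obj.map (a v).op b) (key _)
    exact (ht b fun _ => rfl).trans (ht c fun v => (congrFun hbc v).symm).symm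
  · intro x
    obtain ⟨t, ht, -⟩ := h1 x (key _)
    exact ⟨t, funext ht⟩

/-- Over the part of `𝒳` at `v` a sheaf for `topologyOn S` depends only on the `special v`-space `X_v`,
not on the generic component. -/
theorem bijective_restrictToSkyscraper (C : SheafOn D S) (v : S) (X : Obj D) :
    Function.Bijective (C.obj.map (X.restrictToSkyscraper v.1).op) := by
  have hs : ∀ w ∈ S, ∃ s : C((Obj.skyscraper v.1 (X.sp v.1)).sp w, (X.restrict {v.1}).sp w),
      (∀ x, GSpace.Hom.map (Obj.Hom.sp (X.restrictToSkyscraper v.1) w) (s x) = x) ∧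
      ∀ x, s (GSpace.Hom.map (Obj.Hom.sp (X.restrictToSkyscraper v.1) w) x) = x := by
    intro w hw
    by_cases h : w = v.1
    · subst h
      exact ⟨⟨fun x => ⟨x.1, rfl⟩, Continuous.subtype_mk continuous_subtype_val _⟩,
        fun _ => rfl, fun _ => rfl⟩
    · have : IsEmpty ((Obj.skyscraper v.1 (X.sp v.1)).sp w) := isEmpty_skyscraper h _
      exact ⟨⟨fun x => isEmptyElim x, continuous_of_const fun x => isEmptyElim x⟩,
        fun x => isEmptyElim x, fun x => (h x.2).elim⟩
  choose s hs1 hs2 using hs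
  exact bijective_map_of_sections C _ s hs1 fun w hw => Function.LeftInverse.injective (hs2 w hw)

theorem skyscraperFunctor_coverPreserving (S : Set I) (v : I) :
    CoverPreserving (GSpace.localSectionTopology (D.special v)) (D.topologyOn S)
      (D.skyscraperFunctor v) where
  cover_preserve {X R} hR w _ := by
    rintro ⟨x, hx⟩
    obtain rfl : w = v := hx
    obtain ⟨Y, g, hg, V, hV, hxV, s, hs⟩ := hR x
    let V' : Set (((D.skyscraperFunctor w).obj X).sp w) := {p | p.1 ∈ V}
    have h0 : Continuous fun p : ((D.skyscraperFunctor w).obj X).sp w => (p.1 : X) :=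
      continuous_subtype_val
    have h1 : Continuous fun p : V' => (⟨p.1.1, p.2⟩ : V) :=
      Continuous.subtype_mk (h0.comp continuous_subtype_val) _
    let s' : C(V', ((D.skyscraperFunctor w).obj Y).sp w) :=
      ⟨fun y => ⟨s ⟨y.1.1, y.2⟩, rfl⟩, Continuous.subtype_mk (s.continuous.comp h1) _⟩
    exact ⟨_, (D.skyscraperFunctor w).map g, ⟨Y, g, 𝟙 _, hg, (Category.id_comp _).symm⟩,
      V', hV.preimage continuous_subtype_val, hxV, s', fun y => Subtype.ext (hs ⟨y.1.1, y.2⟩)⟩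

theorem skyscraperFunctor_compatible (S : Set I) (v : I) :
    CompatiblePreserving.{u + 1} (D.topologyOn S) (D.skyscraperFunctor v) where
  compatible ℱ Z T x hx Y₁ Y₂ X f₁ f₂ g₁ g₂ hg₁ hg₂ e := by
    have hw : ∀ (w : I) (t : X.sp w), GSpace.Hom.map g₁ (GSpace.Hom.map (Obj.Hom.sp f₁ w) t).1 =
        GSpace.Hom.map g₂ (GSpace.Hom.map (Obj.Hom.sp f₂ w) t).1 := fun w t =>
      congrArg (fun k : X ⟶ (D.skyscraperFunctor v).obj Z => (GSpace.Hom.map (Obj.Hom.sp k w) t).1) e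
    let l : X ⟶ (D.skyscraperFunctor v).obj (GSpace.fiber g₁ g₂) :=
      { gen := ⟨⟨fun _ => PUnit.unit, continuous_const⟩, fun _ _ => rfl⟩
        sp := fun w => ⟨⟨fun t => ⟨⟨((GSpace.Hom.map (Obj.Hom.sp f₁ w) t).1,
            (GSpace.Hom.map (Obj.Hom.sp f₂ w) t).1), hw w t⟩,
            (GSpace.Hom.map (Obj.Hom.sp f₁ w) t).2⟩,
            Continuous.subtype_mk (Continuous.subtype_mk
              ((continuous_subtype_val.comp (map_continuous _)).prodMk
                (continuous_subtype_val.comp (map_continuous _))) _) _⟩,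
          fun g t => Subtype.ext (Subtype.ext (Prod.ext
            (congrArg Subtype.val (GSpace.Hom.map_smul (Obj.Hom.sp f₁ w) g t))
            (congrArg Subtype.val (GSpace.Hom.map_smul (Obj.Hom.sp f₂ w) g t))))⟩
        comm := fun _ _ => rfl }
    have h := hx (GSpace.fiberFst g₁ g₂) (GSpace.fiberSnd g₁ g₂) hg₁ hg₂
      (GSpace.fiber_condition g₁ g₂)
    have h' := congrArg (ℱ.obj.map l.op) h
    refine Eq.trans ?_ (h'.trans ?_)
    · exact Functor.map_comp_apply ℱ.obj
        ((D.skyscraperFunctor v).map (GSpace.fiberFst g₁ g₂)).op l.op (x g₁ hg₁)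
    · exact (Functor.map_comp_apply ℱ.obj
        ((D.skyscraperFunctor v).map (GSpace.fiberSnd g₁ g₂)).op l.op (x g₂ hg₂)).symm

instance (S : Set I) (v : I) : (D.skyscraperFunctor v).IsContinuous
    (GSpace.localSectionTopology (D.special v)) (D.topologyOn S) :=
  Functor.isContinuous_of_coverPreserving (skyscraperFunctor_compatible S v)
    (skyscraperFunctor_coverPreserving S v)

end GroupDiagram

namespace GroupDiagram

variable {I : Type u} {D : GroupDiagram.{u} I}

/-! ### The components of a sheaf supported on a set of components -/

variable {B : Sheaf D.topology AddCommGrpCat.{u + 1}} {S : Set I}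

theorem naturality_apply {C : Type (u + 1)} [Category.{u} C] {P Q : Cᵒᵖ ⥤ AddCommGrpCat.{u + 1}}
    (g : P ⟶ Q) {X Y : C} (f : X ⟶ Y) (b : P.obj (op Y)) :
    g.app (op X) (P.map f.op b) = Q.map f.op (g.app (op Y) b) :=
  congrArg (fun k => k b) (g.naturality f.op)

/-- The object concentrated at `v` with component `X_v`. -/
abbrev Obj.atComponent (v : I) (X : Obj D) : Obj D :=
  (D.skyscraperFunctor v).obj ((D.spFunctor v).obj X)

/-- The sheaf `X ↦ B(skyscraper of X at v)` on the `special v`-spaces. -/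
noncomputable def IsSupportedOn.componentSheaf (hB : IsSupportedOn B S) (v : I) :
    Sheaf (GSpace.localSectionTopology.{0, u} (D.special v)) AddCommGrpCat.{u + 1} :=
  ((D.skyscraperFunctor v).sheafPushforwardContinuous _ _ (D.topologyOn S)).obj ⟨B.obj, hB.isSheaf⟩

/-- Sections over the object concentrated at `v` with component `X_v` are the same as sections over
the part of `𝒳` at `v`. -/
noncomputable def IsSupportedOn.skyscraperEquiv (hB : IsSupportedOn B S) (v : S) (X : Obj D) :
    B.obj.obj (op (X.atComponent v.1)) ≃+ B.obj.obj (op (X.restrict {v.1})) :=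
  AddEquiv.ofBijective (B.obj.map (X.restrictToSkyscraper v.1).op).hom
    (bijective_restrictToSkyscraper ⟨B.obj, hB.isSheaf⟩ v X)

/-- Restriction of a section over `𝒳` to its component at `v`. -/
noncomputable def IsSupportedOn.componentMap (hB : IsSupportedOn B S) (v : S) (X : Obj D) :
    B.obj.obj (op X) →+ B.obj.obj (op (X.atComponent v.1)) :=
  (hB.skyscraperEquiv v X).symm.toAddMonoidHom.comp (B.obj.map (X.restrictι {v.1}).op).hom

theorem IsSupportedOn.map_componentMap (hB : IsSupportedOn B S) (v : S) (X : Obj D)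
    (b : B.obj.obj (op X)) :
    B.obj.map (X.restrictToSkyscraper v.1).op (hB.componentMap v X b) =
      B.obj.map (X.restrictι {v.1}).op b :=
  (hB.skyscraperEquiv v X).apply_symm_apply _

theorem IsSupportedOn.componentMap_eq_iff (hB : IsSupportedOn B S) (v : S) (X : Obj D)
    (b : B.obj.obj (op X)) (e : B.obj.obj (op (X.atComponent v.1))) :
    hB.componentMap v X b = e ↔
      B.obj.map (X.restrictToSkyscraper v.1).op e = B.obj.map (X.restrictι {v.1}).op b := by
  rw [← hB.map_componentMap v X b, eq_comm]
  exact ((hB.skyscraperEquiv v X).injective.eq_iff).symm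

/-- The map from `B` to the direct image of its component at `v`. -/
noncomputable def IsSupportedOn.toComponent (hB : IsSupportedOn B S) (v : S) :
    B ⟶ (D.spDirectImage v.1).obj (hB.componentSheaf v.1) :=
  ObjectProperty.homMk
    { app := fun X => AddCommGrpCat.ofHom (hB.componentMap v X.unop)
      naturality := fun X Y f => by
        refine AddCommGrpCat.hom_ext (AddMonoidHom.ext fun b => ?_)
        refine (hB.componentMap_eq_iff v Y.unop _ _).2 ?_
        have h : ∀ c : B.obj.obj (op X.unop),
            B.obj.map (Y.unop.restrictToSkyscraper v.1).op (B.obj.map ((D.skyscraperFunctor v.1).map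
              ((D.spFunctor v.1).map f.unop)).op (hB.componentMap v X.unop c)) =
            B.obj.map (Y.unop.restrictι {v.1}).op (B.obj.map f.unop.op c) := fun c => by
          rw [map_op_comp, ← Obj.restrictToSkyscraper_naturality, ← map_op_comp, map_componentMap,
            map_op_comp, map_op_comp, Obj.restrictMap_ι]
        exact h b }

/-- The inclusion of `X_v` as the component at `v` of the part of `𝒳` at `v`. -/
def toRestrictSp (v : I) (X : Obj D) :
    (D.spFunctor v).obj X ⟶ (D.spFunctor v).obj (X.restrict {v}) :=
  ⟨⟨fun x => ⟨x, rfl⟩, Continuous.subtype_mk continuous_id _⟩, fun _ _ => rfl⟩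

/-- The map from `B` to the direct image of its component at `v` is universal among the maps to
direct images from the component `v`. -/
theorem IsSupportedOn.bijective_toComponent_comp (hB : IsSupportedOn B S) (v : S)
    (E : Sheaf (GSpace.localSectionTopology.{0, u} (D.special v.1)) AddCommGrpCat.{u + 1}) :
    Function.Bijective fun k : hB.componentSheaf v.1 ⟶ E =>
      hB.toComponent v ≫ (D.spDirectImage v.1).map k := by
  constructor
  · intro k k' hkk
    refine Sheaf.hom_ext (NatTrans.ext (funext fun X => AddCommGrpCat.hom_ext
      (AddMonoidHom.ext fun e => ?_)))
    let Y := (D.skyscraperFunctor v.1).obj X.unop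
    let m := ofSkyscraperSp v.1 X.unop
    have he' : ∀ c : B.obj.obj (op Y),
        hB.componentMap v Y c = B.obj.map ((D.skyscraperFunctor v.1).map m).op c := by
      intro c
      refine (hB.componentMap_eq_iff v Y _ _).2 ?_
      rw [map_op_comp]
      congr 4
      refine Obj.Hom.ext rfl (funext fun w => GSpace.hom_ext ?_)
      rintro ⟨x, hx⟩
      obtain rfl : w = v.1 := hx
      rfl
    have he : hB.componentMap v Y e = (hB.componentSheaf v.1).obj.map m.op e := he' e
    have h1 : k.hom.app (op ((D.spFunctor v.1).obj Y)) (hB.componentMap v Y e) =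
        k'.hom.app (op ((D.spFunctor v.1).obj Y)) (hB.componentMap v Y e) :=
      congrArg (fun t : B ⟶ (D.spDirectImage v.1).obj E => t.hom.app (op Y) e) hkk
    rw [he, naturality_apply, naturality_apply] at h1
    have h2 := congrArg (E.obj.map (toSkyscraperSp v.1 X.unop).op) h1
    rw [map_op_comp, map_op_comp, toSkyscraperSp_of, op_id, E.obj.map_id] at h2
    exact h2
  · intro g
    let k : (hB.componentSheaf v.1) ⟶ E := ObjectProperty.homMk
      { app := fun X => g.hom.app (op ((D.skyscraperFunctor v.1).obj X.unop)) ≫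
          E.obj.map (toSkyscraperSp v.1 X.unop).op
        naturality := fun X Y f => by
          refine AddCommGrpCat.hom_ext (AddMonoidHom.ext fun e => ?_)
          refine (congrArg (E.obj.map (toSkyscraperSp v.1 Y.unop).op)
            (naturality_apply g.hom ((D.skyscraperFunctor v.1).map f.unop) e)).trans ?_
          exact (map_op_comp E.obj (toSkyscraperSp v.1 Y.unop) ((D.spFunctor v.1).map
            ((D.skyscraperFunctor v.1).map f.unop)) _).trans
            (map_op_comp E.obj f.unop (toSkyscraperSp v.1 X.unop) _).symm }
    refine ⟨k, Sheaf.hom_ext (NatTrans.ext (funext fun X => AddCommGrpCat.hom_ext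
      (AddMonoidHom.ext fun b => ?_)))⟩
    obtain ⟨X⟩ := X
    change E.obj.map (toSkyscraperSp v.1 (X.sp v.1)).op
      (g.hom.app (op (X.atComponent v.1)) (hB.componentMap v X b)) = g.hom.app (op X) b
    have h1 := congrArg (g.hom.app (op (X.restrict {v.1}))) (hB.map_componentMap v X b)
    have h2 := congrArg (E.obj.map (toRestrictSp v.1 X).op)
      (((naturality_apply g.hom (X.restrictToSkyscraper v.1) (hB.componentMap v X b)).symm.trans
        h1).trans (naturality_apply g.hom (X.restrictι {v.1}) b))
    refine Eq.trans ?_ (h2.trans ?_)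
    · exact (map_op_comp E.obj (toRestrictSp v.1 X)
        ((D.spFunctor v.1).map (X.restrictToSkyscraper v.1)) _).symm
    · refine (map_op_comp E.obj (toRestrictSp v.1 X)
        ((D.spFunctor v.1).map (X.restrictι {v.1})) _).trans ?_
      have h3 : toRestrictSp v.1 X ≫ (D.spFunctor v.1).map (X.restrictι {v.1}) = 𝟙 _ := rfl
      rw [h3, op_id, E.obj.map_id]
      rfl

theorem IsSupportedOn.bijective_componentMap (hB : IsSupportedOn B S) (X : Obj D) :
    Function.Bijective fun (b : B.obj.obj (op X)) (v : S) => hB.componentMap v X b := by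
  have h := bijective_restrict ⟨B.obj, hB.isSheaf⟩ X
  constructor
  · intro b c hbc
    refine h.1 (funext fun v => ?_)
    have := congrFun hbc v
    exact (hB.skyscraperEquiv v X).symm.injective this
  · intro e
    obtain ⟨b, hb⟩ := h.2 fun v => hB.skyscraperEquiv v X (e v)
    refine ⟨b, funext fun v => ?_⟩
    exact (hB.componentMap_eq_iff v X _ _).2 (congrFun hb v).symm

/-- A section over `𝒳` is the same as a family of sections of the components. -/
noncomputable def IsSupportedOn.sectionsEquiv (hB : IsSupportedOn B S) (X : Obj D) :
    B.obj.obj (op X) ≃+ ∀ v : S, B.obj.obj (op (X.atComponent v.1)) :=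
  AddEquiv.ofBijective (AddMonoidHom.pi fun v => hB.componentMap v X) (hB.bijective_componentMap X)

theorem IsSupportedOn.componentMap_sectionsEquiv_symm (hB : IsSupportedOn B S) (X : Obj D)
    (e : ∀ v : S, B.obj.obj (op (X.atComponent v.1))) (v : S) :
    hB.componentMap v X ((hB.sectionsEquiv X).symm e) = e v :=
  congrFun ((hB.sectionsEquiv X).apply_symm_apply e) v

/-- `B` has the universal property of the product of the direct images of its components. -/
theorem IsSupportedOn.existsUnique_lift (hB : IsSupportedOn B S)
    (T : Sheaf D.topology AddCommGrpCat.{u + 1})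
    (t : ∀ v : S, T ⟶ (D.spDirectImage v.1).obj (hB.componentSheaf v.1)) :
    ∃! l : T ⟶ B, ∀ v, l ≫ hB.toComponent v = t v := by
  let l : T ⟶ B := ObjectProperty.homMk
    { app := fun X => AddCommGrpCat.ofHom ((hB.sectionsEquiv X.unop).symm.toAddMonoidHom.comp
        (AddMonoidHom.pi fun v => ((t v).hom.app X).hom))
      naturality := fun X Y f => by
        refine AddCommGrpCat.hom_ext (AddMonoidHom.ext fun b => ?_)
        apply (hB.sectionsEquiv Y.unop).injective
        refine funext fun v => ?_
        refine (hB.componentMap_sectionsEquiv_symm Y.unop _ v).trans ?_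
        refine (naturality_apply (t v).hom f.unop b).trans ?_
        refine Eq.trans ?_ (naturality_apply (hB.toComponent v).hom f.unop _).symm
        exact congrArg (((D.spDirectImage v.1).obj (hB.componentSheaf v.1)).obj.map f.unop.op)
          (hB.componentMap_sectionsEquiv_symm X.unop (fun w => (t w).hom.app X b) v).symm }
  refine ⟨l, fun v => Sheaf.hom_ext (NatTrans.ext (funext fun X => AddCommGrpCat.hom_ext
    (AddMonoidHom.ext fun b => ?_))), fun l' hl' => Sheaf.hom_ext (NatTrans.ext (funext fun X =>
      AddCommGrpCat.hom_ext (AddMonoidHom.ext fun b => ?_)))⟩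
  · exact hB.componentMap_sectionsEquiv_symm X.unop _ v
  · apply (hB.sectionsEquiv X.unop).injective
    refine funext fun v => ?_
    refine Eq.trans ?_ (hB.componentMap_sectionsEquiv_symm X.unop _ v).symm
    exact congrArg (fun k : T ⟶ (D.spDirectImage v.1).obj (hB.componentSheaf v.1) =>
      k.hom.app X b) (hl' v)

/-- A sheaf supported on finitely many components is the product of the direct images of its
inverse images at these components. -/
theorem isIso_toProd {S : Finset I} (hB : IsSupportedOn B (S : Set I)) : IsIso (D.toProd S B) := by
  let p : ∀ v : S, B ⟶ (D.spDirectImage v.1).obj (hB.componentSheaf v.1) :=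
    fun v => hB.toComponent ⟨v.1, v.2⟩
  let e : ∀ v : S, (D.spInverseImage v.1).obj B ⟶ hB.componentSheaf v.1 := fun v =>
    ((D.spAdjunction v.1).homEquiv _ _).symm (p v)
  have he : ∀ v, (D.spAdjunction v.1).unit.app B ≫ (D.spDirectImage v.1).map (e v) = p v :=
    fun v => ((D.spAdjunction v.1).homEquiv_unit B _ _).symm.trans
      (((D.spAdjunction v.1).homEquiv _ _).apply_symm_apply (p v))
  have hiso : ∀ v, IsIso (e v) := by
    intro v
    rw [isIso_iff_coyoneda_map_bijective]
    intro T
    have h1 := hB.bijective_toComponent_comp ⟨v.1, v.2⟩ T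
    have h2 : (fun k : hB.componentSheaf v.1 ⟶ T => p v ≫ (D.spDirectImage v.1).map k) =
        ((D.spAdjunction v.1).homEquiv B T) ∘ fun k => e v ≫ k := by
      funext k
      rw [Function.comp_apply, Adjunction.homEquiv_unit, Functor.map_comp, ← Category.assoc, he]
    rw [← Function.Bijective.of_comp_iff' ((D.spAdjunction v.1).homEquiv B T).bijective, ← h2]
    exact h1
  rw [isIso_iff_yoneda_map_bijective]
  intro T
  have key := hB.existsUnique_lift T
  constructor
  · intro l l' hll
    obtain ⟨m, -, hm⟩ := key fun v => l ≫ hB.toComponent v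
    refine (hm l fun _ => rfl).trans (hm l' fun v => ?_).symm
    have h3 := congrArg (fun k => k ≫ Pi.π _ (⟨v.1, v.2⟩ : S) ≫
      (D.spDirectImage v.1).map (e ⟨v.1, v.2⟩)) hll
    simp only [toProd, Category.assoc, Limits.Pi.lift_π_assoc] at h3
    rw [he] at h3
    exact h3.symm
  · intro t
    obtain ⟨l, hl, -⟩ := key fun v => t ≫ Pi.π _ (⟨v.1, v.2⟩ : S) ≫
      (D.spDirectImage v.1).map (e ⟨v.1, v.2⟩)
    refine ⟨l, Limits.Pi.hom_ext _ _ fun v => ?_⟩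
    have := hiso v
    rw [← cancel_mono ((D.spDirectImage v.1).map (e v))]
    simp only [toProd, Category.assoc, Limits.Pi.lift_π_assoc]
    rw [he]
    exact (hl ⟨v.1, v.2⟩).trans rfl

end GroupDiagram

/-! ### Sections of exact sequences of sheaves -/

section Sheaves

variable {C : Type (u + 1)} [Category.{u} C] {J : GrothendieckTopology C}

/-- The functor of sections over `U`. -/
abbrev sectionsAt (J : GrothendieckTopology C) (U : C) :
    Sheaf J AddCommGrpCat.{u + 1} ⥤ AddCommGrpCat.{u + 1} :=
  sheafToPresheaf J AddCommGrpCat.{u + 1} ⋙ (evaluation _ _).obj (op U)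

theorem exists_covering_of_epi {P Q : Sheaf J AddCommGrpCat.{u + 1}} (f : P ⟶ Q) [Epi f] {U : C}
    (x : Q.obj.obj (op U)) : ∃ R ∈ J U, ∀ ⦃V : C⦄ (g : V ⟶ U), R g →
      ∃ y : P.obj.obj (op V), f.hom.app (op V) y = Q.obj.map g.op x := by
  have h : Sheaf.IsLocallySurjective f :=
    (Sheaf.isLocallySurjective_iff_epi' AddCommGrpCat.{u + 1} f).2 inferInstance
  exact ⟨Presheaf.imageSieve f.hom x, Presheaf.imageSieve_mem J f.hom x, fun V g hg => hg⟩

theorem injective_app_of_mono {P Q : Sheaf J AddCommGrpCat.{u + 1}} (f : P ⟶ Q) [Mono f] (U : C) :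
    Function.Injective (f.hom.app (op U)) :=
  (AddCommGrpCat.mono_iff_injective _).1 (inferInstanceAs (Mono ((sectionsAt J U).map f)))

/-- In an exact sequence of sheaves, a section with image zero comes locally from the left. -/
theorem exists_covering_of_exact {T : ShortComplex (Sheaf J AddCommGrpCat.{u + 1})} (hT : T.Exact)
    {U : C} (x : T.X₂.obj.obj (op U)) (hx : T.g.hom.app (op U) x = 0) :
    ∃ R ∈ J U, ∀ ⦃V : C⦄ (g : V ⟶ U), R g →
      ∃ y : T.X₁.obj.obj (op V), T.f.hom.app (op V) y = T.X₂.obj.map g.op x := by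
  have h1 := KernelFork.mapIsLimit _ T.cyclesIsKernel (sectionsAt J U)
  let T' : ShortComplex AddCommGrpCat.{u + 1} :=
    ShortComplex.mk ((sectionsAt J U).map T.iCycles) ((sectionsAt J U).map T.g)
      (by rw [← Functor.map_comp, T.iCycles_g, Functor.map_zero])
  have h2 : T'.Exact := T'.exact_of_f_is_kernel h1
  rw [ShortComplex.ab_exact_iff] at h2
  obtain ⟨z, hz⟩ := h2 x hx
  have := hT.epi_toCycles
  obtain ⟨R, hR, h3⟩ := exists_covering_of_epi T.toCycles (U := U) z
  refine ⟨R, hR, fun V g hg => ?_⟩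
  obtain ⟨y, hy⟩ := h3 g hg
  refine ⟨y, ?_⟩
  have h4 := congrArg (fun k => k.hom.app (op V) y) T.toCycles_i
  refine h4.symm.trans ?_
  refine (congrArg (T.iCycles.hom.app (op V)) hy).trans ?_
  refine (GroupDiagram.naturality_apply T.iCycles.hom g z).trans ?_
  exact congrArg (T.X₂.obj.map g.op) hz

end Sheaves

namespace GroupDiagram

variable {I : Type u} {D : GroupDiagram.{u} I}

/-! ### Support of the higher direct images -/

/-- The object with generic component `U` and all other components empty. -/
def Obj.ofGen (U : GSpace.{u, u} D.generic) : Obj D where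
  gen := U
  sp v :=
    letI : MulAction (D.special v) PEmpty.{u + 1} :=
      { smul := fun _ x => x, one_smul := fun x => x.elim, mul_smul := fun _ _ x => x.elim }
    haveI : ContinuousSMul (D.special v) PEmpty.{u + 1} := ⟨continuous_snd⟩
    ⟨PEmpty.{u + 1}⟩
  f _ := ⟨fun x => x.elim, continuous_of_const fun x => x.elim⟩
  f_smul _ _ x := x.elim

/-- The map to `𝒳` given by a map to its generic component. -/
def Obj.ofGenHom {U : GSpace.{u, u} D.generic} {X : Obj D} (t : U ⟶ X.gen) : Obj.ofGen U ⟶ X where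
  gen := t
  sp _ := ⟨⟨fun x => x.elim, continuous_of_const fun x => x.elim⟩, fun _ x => x.elim⟩
  comm _ x := x.elim

theorem coversGen_functorPullback {X : Obj D} {T : Sieve X.gen}
    (hT : T ∈ GSpace.localSectionTopology D.generic X.gen) :
    CoversGen (T.functorPullback D.genFunctor (X := X)) := fun x => by
  obtain ⟨U, t, ht, V, hV, hx, s, hs⟩ := hT x
  exact ⟨Obj.ofGen U, Obj.ofGenHom t, ht, V, hV, hx, s, hs⟩

/-- The `G`-space `G × Z`, on which `G` acts through left multiplication on the first factor. -/
def freeSpace (G : Type w) [Group G] [TopologicalSpace G] [ContinuousMul G] (Z : Type (max u w))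
    [TopologicalSpace Z] : GSpace.{w, max u w} G :=
  letI : MulAction G (G × Z) :=
    { smul := fun g p => (g * p.1, p.2)
      one_smul := fun p => Prod.ext (one_mul p.1) rfl
      mul_smul := fun a b p => Prod.ext (mul_assoc a b p.1) rfl }
  haveI : ContinuousSMul G (G × Z) :=
    ⟨(continuous_fst.mul (continuous_fst.comp continuous_snd)).prodMk
      (continuous_snd.comp continuous_snd)⟩
  ⟨G × Z⟩

/-- The equivariant map `G × Z → X` given by a continuous map `Z → X`. -/
def freeLift {G : Type w} [Group G] [TopologicalSpace G] [ContinuousMul G] {Z : Type (max u w)}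
    [TopologicalSpace Z] {X : GSpace.{w, max u w} G} (a : C(Z, X)) : freeSpace.{w, u} G Z ⟶ X :=
  ⟨⟨fun p : G × Z => p.1 • a p.2, continuous_fst.smul (a.continuous.comp continuous_snd)⟩,
    fun g p => mul_smul g p.1 (a p.2)⟩

/-- The object with generic component `generic × Z`, with component `special v × Z` at `v` and with
empty components elsewhere; its specialization map is induced by a homomorphism
`special v → generic` that makes the local group at `v` redundant. -/
def freeObj [ContinuousMul D.generic] (v : I) [ContinuousMul (D.special v)]
    (h : D.special v →* D.generic) (hc : Continuous h)
    (hh : ∀ g, h (D.toSpecial v g) = D.toGeneric v g) (Z : Type u) [TopologicalSpace Z] : Obj D where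
  gen := freeSpace.{u, u} D.generic Z
  sp := (Obj.skyscraper v (freeSpace.{0, u} (D.special v) Z)).sp
  f _ := ⟨fun p => (h p.1.1, p.1.2), by
    have h1 : Continuous fun q : D.special v × Z => ((h q.1, q.2) : D.generic × Z) :=
      (hc.comp continuous_fst).prodMk continuous_snd
    exact h1.comp continuous_subtype_val⟩
  f_smul w g p := by
    obtain ⟨⟨k, z⟩, hw⟩ := p
    obtain rfl : w = v := hw
    refine Prod.ext ?_ rfl
    change h (D.toSpecial w g * k) = D.toGeneric w g * h k
    rw [map_mul, hh]

/-- The map from `freeObj` to `𝒳` given by a continuous map `Z → X_v`. -/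
def freeObjHom [ContinuousMul D.generic] {v : I} [ContinuousMul (D.special v)]
    {h : D.special v →* D.generic} (hc : Continuous h)
    (hh : ∀ g, h (D.toSpecial v g) = D.toGeneric v g)
    (hs : Function.Surjective (D.toSpecial v)) {Z : Type u} [TopologicalSpace Z] {X : Obj D}
    (a : C(Z, X.sp v)) : freeObj v h hc hh Z ⟶ X where
  gen := freeLift ((X.f v).comp a)
  sp w := by
    refine ⟨⟨fun p => (p.2 : w = v) ▸ GSpace.Hom.map (freeLift.{0, u} a) p.1, ?_⟩, ?_⟩
    · by_cases hw : w = v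
      · subst hw
        exact (map_continuous (GSpace.Hom.map (freeLift.{0, u} a))).comp continuous_subtype_val
      · have : IsEmpty ((freeObj v h hc hh Z).sp w) := isEmpty_skyscraper hw _
        exact continuous_of_const fun x => isEmptyElim x
    · rintro g ⟨p, hp⟩
      obtain rfl : w = v := hp
      exact GSpace.Hom.map_smul (freeLift.{0, u} a) g p
  comm w p := by
    obtain ⟨⟨k, z⟩, hw⟩ := p
    obtain rfl : w = v := hw
    obtain ⟨g, rfl⟩ := hs k
    change h (D.toSpecial w g) • X.f w (a z) = X.f w (D.toSpecial w g • a z)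
    rw [hh, X.f_smul]

/-- At an index `v` at which `loc v → generic` factors through `special v`, a covering of the generic
component pulls back to a sieve that covers at `v`: if `Z ⊆ X_v` is open and its image in the generic
component lifts to `U`, then the generic component `generic × Z` of `freeObj` maps to `U` over
`X_{v₀}`. -/
theorem coversAt_functorPullback [ContinuousMul D.generic] {v : I} [ContinuousMul (D.special v)]
    {h : D.special v →* D.generic} (hc : Continuous h)
    (hh : ∀ g, h (D.toSpecial v g) = D.toGeneric v g)
    (hs : Function.Surjective (D.toSpecial v)) {X : Obj D} {T : Sieve X.gen}
    (hT : T ∈ GSpace.localSectionTopology D.generic X.gen) :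
    CoversAt v (T.functorPullback D.genFunctor (X := X)) := fun x => by
  obtain ⟨U, t, ht, V, hV, hx, s, hst⟩ := hT (X.f v x)
  let Z : Set (X.sp v) := X.f v ⁻¹' V
  let a : C(Z, X.sp v) := ⟨Subtype.val, continuous_subtype_val⟩
  let b : C(Z, U) := ⟨fun z => s ⟨X.f v z.1, z.2⟩, s.continuous.comp
    (Continuous.subtype_mk ((X.f v).continuous.comp continuous_subtype_val) _)⟩
  refine ⟨freeObj v h hc hh Z, freeObjHom hc hh hs a, ?_, Z, hV.preimage (X.f v).continuous, hx,
    ⟨fun z => ⟨(1, z), rfl⟩, Continuous.subtype_mk (continuous_const.prodMk continuous_id) _⟩,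
    fun z => one_smul _ z.1⟩
  have h1 : Obj.Hom.gen (freeObjHom hc hh hs a) = freeLift b ≫ t := by
    refine GSpace.hom_ext fun p => ?_
    obtain ⟨g, z⟩ := p
    change g • X.f v z.1 = GSpace.Hom.map t (g • b z)
    rw [GSpace.Hom.map_smul]
    exact congrArg (g • ·) (hst ⟨X.f v z.1, z.2⟩).symm
  change T (Obj.Hom.gen (freeObjHom hc hh hs a))
  rw [h1]
  exact T.downward_closed ht _

/-- The higher direct images of sheaves on the generic component are supported on `S` if at every
`v ∉ S` the map `loc v → generic` factors through `special v`. A section is locally represented by a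
cocycle, which is a coboundary on a covering of the generic component; by `coversAt_functorPullback`
the pulled back covering of `𝒳` also covers at `v ∉ S`. -/
theorem isSupportedOn_genHigherDirectImage [ContinuousMul D.generic]
    [∀ v, ContinuousMul (D.special v)] {S : Set I}
    (hs : ∀ v, Function.Surjective (D.toSpecial v))
    (hS : ∀ v ∉ S, ∃ h : D.special v →* D.generic, Continuous h ∧
      ∀ g, h (D.toSpecial v g) = D.toGeneric v g)
    (E : Sheaf (GSpace.localSectionTopology.{u, u} D.generic) AddCommGrpCat.{u + 1})
    {q : ℕ} (hq : 0 < q) : IsSupportedOn ((D.genHigherDirectImage q).obj E) S := by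
  obtain ⟨n, rfl⟩ : ∃ n, q = n + 1 := ⟨q - 1, by omega⟩
  intro X b
  let R := InjectiveResolution.of E
  let K := (D.genDirectImage.mapHomologicalComplex (ComplexShape.up ℕ)).obj R.cocomplex
  let e : (D.genHigherDirectImage (n + 1)).obj E ≅ K.homology (n + 1) :=
    R.isoRightDerivedObj D.genDirectImage (n + 1)
  let ψ : K.cycles (n + 1) ⟶ (D.genHigherDirectImage (n + 1)).obj E :=
    K.homologyπ (n + 1) ≫ e.inv
  have hψ : K.toCycles n (n + 1) ≫ ψ = 0 := by
    rw [← Category.assoc, K.toCycles_comp_homologyπ, zero_comp]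
  -- A cycle is a boundary after restriction to a covering of the generic component.
  have key : ∀ (Y : Obj D) (z : (K.cycles (n + 1)).obj.obj (op Y)),
      ∃ T ∈ GSpace.localSectionTopology D.generic Y.gen, ∀ ⦃Z : Obj D⦄ (g : Z ⟶ Y),
        T (Obj.Hom.gen g) → ψ.hom.app (op Z) ((K.cycles (n + 1)).obj.map g.op z) = 0 := by
    intro Y z
    let ζ : (R.cocomplex.X (n + 1)).obj.obj (op Y.gen) := (K.iCycles (n + 1)).hom.app (op Y) z
    have hζ : (R.cocomplex.d (n + 1) (n + 2)).hom.app (op Y.gen) ζ = 0 :=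
      congrArg (fun k => k.hom.app (op Y) z) (K.iCycles_d (n + 1) (n + 2))
    obtain ⟨T, hT, h1⟩ := exists_covering_of_exact (R.exact_succ n) ζ hζ
    refine ⟨T, hT, fun Z g hg => ?_⟩
    obtain ⟨y, hy⟩ := h1 (Obj.Hom.gen g) hg
    let y' : (K.X n).obj.obj (op Z) := y
    have h2 : (K.cycles (n + 1)).obj.map g.op z = (K.toCycles n (n + 1)).hom.app (op Z) y' := by
      apply injective_app_of_mono (K.iCycles (n + 1)) Z
      refine (naturality_apply (K.iCycles (n + 1)).hom g z).trans ?_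
      refine Eq.trans ?_ (congrArg (fun k => k.hom.app (op Z) y')
        (K.toCycles_i n (n + 1))).symm
      exact hy.symm
    rw [h2]
    exact congrArg (fun k => k.hom.app (op Z) y') hψ
  obtain ⟨R₀, hR₀, h0⟩ := exists_covering_of_epi ψ b
  rw [mem_topology_iff] at hR₀
  let L : Sieve X :=
    { arrows := fun Y f => ((D.genHigherDirectImage (n + 1)).obj E).obj.map f.op b = 0
      downward_closed := fun {Y Z f} hf g => by
        rw [← map_op_comp, hf, map_zero] }
  have hL : ∀ ⦃Y : Obj D⦄ (f : Y ⟶ X), R₀ f →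
      ∃ T ∈ GSpace.localSectionTopology D.generic Y.gen,
        T.functorPullback D.genFunctor (X := Y) ≤ L.pullback f := by
    intro Y f hf
    obtain ⟨z, hz⟩ := h0 f hf
    obtain ⟨T, hT, h1⟩ := key Y z
    refine ⟨T, hT, fun Z g hg => ?_⟩
    change ((D.genHigherDirectImage (n + 1)).obj E).obj.map (g ≫ f).op b = 0
    rw [← map_op_comp, ← hz, ← naturality_apply]
    exact h1 g hg
  refine ⟨L, hR₀.1.transitive fun Y f hf => ?_, fun v hv => (hR₀.2 v).transitive fun Y f hf => ?_,
    fun Y f hf => hf⟩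
  · obtain ⟨T, hT, h1⟩ := hL f hf
    exact (coversGen_functorPullback hT).mono h1
  · obtain ⟨T, hT, h1⟩ := hL f hf
    obtain ⟨h, hc, hh⟩ := hS v hv
    exact (coversAt_functorPullback hc hh (hs v) hT).mono h1

end GroupDiagram

/-! ### Places and topologically nilpotent elements -/

namespace Place

variable {F : Type u} [Field F] [NumberField F]

instance (v : Place F) : IsTopologicalRing v.Completion :=
  match v with
  | finite v => inferInstanceAs (IsTopologicalRing (v.adicCompletion F))
  | infinite v => inferInstanceAs (IsTopologicalRing v.Completion)

instance (v : Place F) : IsTopologicalGroup v.ResidueGroup :=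
  match v with
  | finite _ => inferInstanceAs (IsTopologicalGroup (Multiplicative ℤ))
  | infinite _ => inferInstanceAs (IsTopologicalGroup (Multiplicative ℝ))

theorem isTopologicallyNilpotent_finite_iff {v : HeightOneSpectrum (𝓞 F)}
    (x : v.adicCompletion F) : IsTopologicallyNilpotent x ↔ Valued.v x < 1 := by
  constructor
  · intro h
    have hU : {y : v.adicCompletion F | Valued.v y < 1} ∈ nhds 0 :=
      by
      have h1 := (Valued.isOpen_ball (v.adicCompletion F) 1).mem_nhds (x := 0) (by simp)
      simpa only [Valuation.restrict_lt_one_iff] using h1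
    obtain ⟨n, hn⟩ := h.exists_pow_mem_of_mem_nhds hU
    by_contra hx
    rw [not_lt] at hx
    have : Valued.v (x ^ n) < 1 := hn
    rw [map_pow] at this
    exact absurd this (not_lt.2 (one_le_pow_of_one_le' hx n))
  · exact fun h => Valued.tendsto_zero_pow_of_v_lt_one h

theorem isTopologicallyNilpotent_infinite_iff {L : Type u} [Field L] {v : InfinitePlace L}
    (x : v.Completion) : IsTopologicallyNilpotent x ↔ ‖x‖ < 1 := by
  rw [IsTopologicallyNilpotent, tendsto_zero_iff_norm_tendsto_zero]
  simp only [norm_pow]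
  rw [tendsto_pow_atTop_nhds_zero_iff, abs_norm]

/-- The elements of valuation `1` are those for which neither the element nor its inverse is
topologically nilpotent; this characterizes them through the topology of the completion. -/
theorem valuation_eq_one_iff (v : Place F) (a : v.Completionˣ) : v.valuation a = 1 ↔
    ¬ IsTopologicallyNilpotent (a : v.Completion) ∧
      ¬ IsTopologicallyNilpotent ((a⁻¹ : v.Completionˣ) : v.Completion) := by
  rcases v with v | v
  · change (v.adicCompletion F)ˣ at a
    have h1 : (finite v).valuation a = 1 ↔ Valued.v (a : v.adicCompletion F) = 1 := by
      change (WithZero.unitsWithZeroEquiv (Units.map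
        (Valued.v : Valuation (v.adicCompletion F) _).toMonoidHom a))⁻¹ = 1 ↔ _
      rw [inv_eq_one, EmbeddingLike.map_eq_one_iff, Units.ext_iff]
      rfl
    rw [h1]
    change _ ↔ ¬ IsTopologicallyNilpotent (a : v.adicCompletion F) ∧
      ¬ IsTopologicallyNilpotent ((a⁻¹ : (v.adicCompletion F)ˣ) : v.adicCompletion F)
    rw [isTopologicallyNilpotent_finite_iff, isTopologicallyNilpotent_finite_iff,
      Units.val_inv_eq_inv_val, map_inv₀, not_lt, not_lt,
      one_le_inv₀ (zero_lt_iff.2 ((Valuation.ne_zero_iff _).2 a.ne_zero)), and_comm]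
    exact le_antisymm_iff
  · change v.Completionˣ at a
    have h1 : (infinite v).valuation a = 1 ↔ Real.log ‖(a : v.Completion)‖ = 0 := Iff.rfl
    rw [h1]
    change _ ↔ ¬ IsTopologicallyNilpotent (a : v.Completion) ∧
      ¬ IsTopologicallyNilpotent ((a⁻¹ : v.Completionˣ) : v.Completion)
    have hpos : 0 < ‖(a : v.Completion)‖ := norm_pos_iff.2 a.ne_zero
    rw [isTopologicallyNilpotent_infinite_iff, isTopologicallyNilpotent_infinite_iff,
      Units.val_inv_eq_inv_val, norm_inv, not_lt, not_lt, one_le_inv₀ hpos, and_comm,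
      ← le_antisymm_iff]
    constructor
    · intro h
      rw [← Real.exp_log hpos, h, Real.exp_zero]
    · intro h
      rw [h, Real.log_one]

theorem isTopologicallyNilpotent_algebraMap_finite {v : HeightOneSpectrum (𝓞 F)} (e : F) :
    IsTopologicallyNilpotent (algebraMap F (finite v).Completion e) ↔ v.valuation F e < 1 := by
  change IsTopologicallyNilpotent (algebraMap F (v.adicCompletion F) e) ↔ _
  rw [isTopologicallyNilpotent_finite_iff]
  rw [← v.valuedAdicCompletion_eq_valuation' e]
  rfl

theorem isTopologicallyNilpotent_algebraMap_infinite {v : InfinitePlace F} (e : F) :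
    IsTopologicallyNilpotent (algebraMap F (infinite v).Completion e) ↔ v e < 1 := by
  change IsTopologicallyNilpotent (algebraMap F v.Completion e) ↔ _
  rw [isTopologicallyNilpotent_infinite_iff]
  have : ‖algebraMap F v.Completion e‖ = v e :=
    InfinitePlace.Completion.norm_coe v ((WithAbs.equiv v.1).symm e)
  rw [this]

/-- Some integer `n > 1` has `v`-adic absolute value less than `1`, which distinguishes finite places
from archimedean ones. -/
theorem exists_natCast_valuation_lt_one (v : HeightOneSpectrum (𝓞 F)) :
    ∃ n : ℕ, 1 < n ∧ v.valuation F (n : F) < 1 := by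
  refine ⟨Ideal.absNorm v.asIdeal, HeightOneSpectrum.one_lt_absNorm v, ?_⟩
  have h := (v.valuation_lt_one_iff_mem (K := F) (Ideal.absNorm v.asIdeal : 𝓞 F)).2
    (Ideal.absNorm_mem v.asIdeal)
  simpa using h

/-- If all elements of `F` that are topologically nilpotent at `v` are so at the place `w` of an
extension, then `w` lies over `v`. -/
theorem under_eq_of_isTopologicallyNilpotent {E : Type u} [Field E] [NumberField E] [Algebra F E]
    (v : Place F) (w : Place E)
    (h : ∀ e : F, IsTopologicallyNilpotent (algebraMap F v.Completion e) →
      IsTopologicallyNilpotent (algebraMap E w.Completion (algebraMap F E e))) :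
    w.under F = v := by
  rcases v with v | v <;> rcases w with w | w
  · simp only [isTopologicallyNilpotent_algebraMap_finite] at h
    have hle : v.asIdeal ≤ (w.under (𝓞 F)).asIdeal := by
      intro x hx
      have h1 := h (algebraMap (𝓞 F) F x) ((v.valuation_lt_one_iff_mem x).2 hx)
      exact (w.valuation_lt_one_iff_mem (K := E) (algebraMap (𝓞 F) (𝓞 E) x)).1 h1
    have h2 : v.asIdeal = (w.under (𝓞 F)).asIdeal :=
      v.isMaximal.eq_of_le (w.under (𝓞 F)).isPrime.ne_top hle
    exact congrArg finite (HeightOneSpectrum.ext h2.symm)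
  · simp only [isTopologicallyNilpotent_algebraMap_finite,
      isTopologicallyNilpotent_algebraMap_infinite] at h
    obtain ⟨n, hn, h1⟩ := exists_natCast_valuation_lt_one v
    have h2 := h n h1
    rw [map_natCast, InfinitePlace.map_natCast] at h2
    exact absurd h2 (not_lt.2 (by exact_mod_cast hn.le))
  · simp only [isTopologicallyNilpotent_algebraMap_finite,
      isTopologicallyNilpotent_algebraMap_infinite] at h
    obtain ⟨n, hn, h1⟩ := exists_natCast_valuation_lt_one w
    have hn0 : (0 : ℝ) < n := by exact_mod_cast (zero_lt_one.trans hn)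
    have h2 := h (n : F)⁻¹ (by
      rw [map_inv₀, InfinitePlace.map_natCast]
      exact inv_lt_one_of_one_lt₀ (by exact_mod_cast hn))
    rw [map_inv₀, map_natCast, map_inv₀] at h2
    have h3 : 0 < w.valuation E (n : E) := zero_lt_iff.2 ((Valuation.ne_zero_iff _).2
      (Nat.cast_ne_zero.2 (by omega)))
    exact absurd h2 (not_lt.2 ((one_le_inv₀ h3).2 h1.le))
  · simp only [isTopologicallyNilpotent_algebraMap_infinite] at h
    refine congrArg infinite ((InfinitePlace.eq_iff_isEquiv).2
      (AbsoluteValue.isEquiv_of_lt_one_imp v.isNontrivial h).symm)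

end Place

/-! ### The residue map of a local Weil group -/

section Residue

variable {F : Type u} [Field F] [NumberField F]

/-- The completion of a number field at an archimedean place contains an isometric copy of `ℝ`. -/
theorem exists_isometry_real {L : Type u} [Field L] (v : InfinitePlace L) :
    ∃ i : ℝ →+* v.Completion, Isometry i := by
  by_cases hv : v.IsReal
  · exact ⟨(InfinitePlace.Completion.ringEquivRealOfIsReal hv).symm.toRingHom,
      (InfinitePlace.Completion.isometryEquivRealOfIsReal hv).symm.isometry⟩
  · have hv' := InfinitePlace.not_isReal_iff_isComplex.1 hv
    exact ⟨(InfinitePlace.Completion.ringEquivComplexOfIsComplex hv').symm.toRingHom.comp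
      Complex.ofRealHom, (InfinitePlace.Completion.isometryEquivComplexOfIsComplex
        hv').symm.isometry.comp Complex.isometry_ofReal⟩

/-- The exponential map as a map to the units of `ℝ`. -/
noncomputable def expUnit (r : ℝ) : ℝˣ :=
  ⟨Real.exp r, Real.exp (-r), by rw [← Real.exp_add]; simp, by rw [← Real.exp_add]; simp⟩

theorem continuous_expUnit : Continuous expUnit :=
  Units.continuous_iff.2 ⟨Real.continuous_exp, Real.continuous_exp.comp continuous_neg⟩

/-- `x ↦ log |x|` has a continuous section, namely `exp` into a copy of `ℝ` in the completion. -/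
theorem exists_continuous_section_valuation (v : InfinitePlace F) :
    ∃ s : (Place.infinite v).ResidueGroup → (Place.infinite v).Completionˣ, Continuous s ∧
      ∀ r, (Place.infinite v).valuation (s r) = r := by
  obtain ⟨i, hi⟩ := exists_isometry_real v
  refine ⟨fun r => Units.map i.toMonoidHom (expUnit (Multiplicative.toAdd (α := ℝ) r)),
    (Continuous.units_map i.toMonoidHom hi.continuous).comp
      (continuous_expUnit.comp continuous_toAdd), fun r => ?_⟩
  change Multiplicative.ofAdd (Real.log ‖i (Real.exp (Multiplicative.toAdd (α := ℝ) r))‖) = r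
  have h : ∀ x : ℝ, ‖i x‖ = |x| := fun x => by
    have := hi.dist_eq x 0
    rwa [map_zero, dist_zero_right, dist_zero_right] at this
  rw [h, abs_of_pos (Real.exp_pos _), Real.log_exp]
  rfl

theorem Place.valuation_surjective (v : Place F) : Function.Surjective v.valuation := by
  rcases v with v | v
  · obtain ⟨π, hπ⟩ := v.valuation_exists_uniformizer F
    have hπ0 : (algebraMap F (v.adicCompletion F) π) ≠ 0 := by
      refine (map_ne_zero _).2 fun h => ?_
      rw [h, map_zero] at hπ
      exact WithZero.exp_ne_zero hπ.symm
    let a : (finite v).Completionˣ := Units.mk0 (algebraMap F (v.adicCompletion F) π) hπ0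
    have ha : (finite v).valuation a = (Multiplicative.ofAdd (1 : ℤ) : Multiplicative ℤ) := by
      change (WithZero.unitsWithZeroEquiv (Units.map
        (Valued.v : Valuation (v.adicCompletion F) _).toMonoidHom a))⁻¹ = _
      rw [inv_eq_iff_eq_inv, ← WithZero.coe_inj]
      refine Eq.trans ?_ hπ
      exact (WithZero.coe_unitsWithZeroEquiv_eq_units_val _).trans
        (v.valuedAdicCompletion_eq_valuation' π)
    intro n
    refine ⟨a ^ (Multiplicative.toAdd (α := ℤ) n), ?_⟩
    rw [map_zpow, ha]
    change (Multiplicative.ofAdd (1 : ℤ)) ^ (Multiplicative.toAdd (α := ℤ) n) = n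
    rw [← ofAdd_zsmul, smul_eq_mul, mul_one]
    rfl
  · obtain ⟨s, -, hs⟩ := exists_continuous_section_valuation v
    exact fun r => ⟨s r, hs r⟩

theorem FinExt.baseUnits_surjective (k : Type u) [Field k] :
    Function.Surjective (FinExt.baseUnits k) :=
  (Units.mapEquiv (IntermediateField.botEquiv k (AlgebraicClosure k)).toMulEquiv).surjective

theorem FinExt.baseUnits_algebraMap (k : Type u) [Field k] (a : kˣ) :
    FinExt.baseUnits k (Units.map (algebraMap k (FinExt.base k).field).toMonoidHom a) = a :=
  Units.ext (AlgEquiv.commutes (IntermediateField.botEquiv k (AlgebraicClosure k)) _)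

theorem FinExt.algebraMap_baseUnits (k : Type u) [Field k] (a : (FinExt.base k).fieldˣ) :
    Units.map (algebraMap k (FinExt.base k).field).toMonoidHom (FinExt.baseUnits k a) = a := by
  refine Units.ext ?_
  apply (IntermediateField.botEquiv k (AlgebraicClosure k)).injective
  exact AlgEquiv.commutes (IntermediateField.botEquiv k (AlgebraicClosure k)) _

/-- An element of a Weil group as an element of the subgroup belonging to the trivial extension,
which is the whole group. -/
def toBase {k : Type u} [Field k] {𝒞 : ClassFieldData k} (W : WeilGroup 𝒞) (g : W.W) :
    weilSubgroup W.φ (FinExt.base k) :=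
  ⟨g, by simp [weilSubgroup, FinExt.base]⟩

/-- The element of `F_vˣ` that corresponds to the class of an element of `W_{F_v}` in its
abelianization. -/
noncomputable def LocalWeilGroup.baseClass {v : Place F} (Wv : LocalWeilGroup v) (g : Wv.W) :
    v.Completionˣ :=
  FinExt.baseUnits v.Completion
    ((Wv.r (FinExt.base v.Completion)).symm (weilClass Wv.φ _ (toBase Wv g)))

theorem LocalWeilGroup.toResidue_apply {v : Place F} (Wv : LocalWeilGroup v) (g : Wv.W) :
    Wv.toResidue g = v.valuation (Wv.baseClass g) := rfl

theorem LocalWeilGroup.weilClass_toBase {v : Place F} (Wv : LocalWeilGroup v) (g : Wv.W) :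
    weilClass Wv.φ (FinExt.base v.Completion) (toBase Wv g) = Wv.r (FinExt.base v.Completion)
      (Units.map (algebraMap v.Completion (FinExt.base v.Completion).field).toMonoidHom
        (Wv.baseClass g)) := by
  rw [LocalWeilGroup.baseClass]
  erw [FinExt.algebraMap_baseUnits]
  exact ((Wv.r (FinExt.base v.Completion)).apply_symm_apply _).symm

theorem LocalWeilGroup.exists_baseClass_eq {v : Place F} (Wv : LocalWeilGroup v)
    (a : v.Completionˣ) : ∃ g : Wv.W, Wv.baseClass g = a := by
  obtain ⟨b, rfl⟩ := FinExt.baseUnits_surjective v.Completion a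
  obtain ⟨x, hx⟩ := QuotientGroup.mk'_surjective _ (Wv.r (FinExt.base v.Completion) b)
  refine ⟨x, congrArg (FinExt.baseUnits v.Completion) ?_⟩
  exact ((Wv.r (FinExt.base v.Completion)).symm_apply_eq).2 hx

theorem LocalWeilGroup.toResidue_surjective {v : Place F} (Wv : LocalWeilGroup v) :
    Function.Surjective Wv.toResidue := fun r => by
  obtain ⟨a, rfl⟩ := v.valuation_surjective r
  obtain ⟨g, rfl⟩ := Wv.exists_baseClass_eq a
  exact ⟨g, rfl⟩

/-- `W_{κ(v)}` carries the quotient topology with respect to the residue map. -/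
theorem LocalWeilGroup.continuous_of_comp_toResidue {v : Place F} (Wv : LocalWeilGroup v)
    {X : Type*} [TopologicalSpace X] (h : v.ResidueGroup → X)
    (hc : Continuous fun g => h (Wv.toResidue g)) : Continuous h := by
  rcases v with v | v
  · have : DiscreteTopology (Place.finite v).ResidueGroup :=
      inferInstanceAs (DiscreteTopology (Multiplicative ℤ))
    exact continuous_of_discreteTopology
  · let k := (Place.infinite v).Completion
    let E := FinExt.base k
    let κ : (localData k (Place.infinite v).integers).C E → X :=
      fun b => h ((Place.infinite v).valuation (FinExt.baseUnits k b))
    have h1 : Continuous (κ ∘ (Wv.r E).symm) := by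
      rw [(QuotientGroup.isQuotientMap_mk _).continuous_iff]
      exact hc.comp continuous_subtype_val
    have h2 : Continuous κ := by
      have h3 := h1.comp (Wv.r E).continuous_toFun
      refine h3.congr fun b => congrArg κ ((Wv.r E).symm_apply_apply b)
    obtain ⟨s, hs, hsr⟩ := exists_continuous_section_valuation v
    let t : k → E.field := algebraMap k E.field
    have ht : @Continuous _ _ _ (moduleTopology k E.field) t := by
      let : TopologicalSpace E.field := moduleTopology k E.field
      have : IsModuleTopology k E.field := ⟨rfl⟩
      have := IsModuleTopology.toContinuousAdd k E.field
      exact IsModuleTopology.continuous_of_linearMap (Algebra.linearMap k E.field)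
    have ht' : @Continuous _ _ _ ((localData k (Place.infinite v).integers).top E)
        (Units.map (algebraMap k E.field).toMonoidHom) := by
      let : TopologicalSpace E.field := moduleTopology k E.field
      exact Continuous.units_map (algebraMap k E.field).toMonoidHom ht
    have h4 : h = κ ∘ (Units.map (algebraMap k E.field).toMonoidHom) ∘ s := by
      funext r
      change h r = h ((Place.infinite v).valuation (FinExt.baseUnits k (Units.map _ (s r))))
      rw [FinExt.baseUnits_algebraMap, hsr]
    rw [h4]
    exact h2.comp (ht'.comp hs)

end Residue

/-! ### Norms through the transfer -/

section Transfer

variable {k : Type u} [Field k] [TopologicalSpace k] {O : Subring k}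

/-- The restriction of an automorphism of `k̄` to an intermediate field that it preserves. -/
noncomputable def restrictHom {k : Type u} [Field k] (E : FinExt k)
    (σ : Gal(AlgebraicClosure k/k)) (h : ∀ x ∈ E.field, σ x ∈ E.field) :
    E.field →ₐ[k] E.field :=
  ((σ : AlgebraicClosure k →ₐ[k] AlgebraicClosure k).comp E.field.val).codRestrict
    E.field.toSubalgebra fun x => h x x.2

theorem weilSubgroup_normal {k : Type u} [Field k] {W : Type u} [Group W]
    (φ : W →* Gal(AlgebraicClosure k/k)) (E : FinExt k)
    (hE : ∀ (σ : Gal(AlgebraicClosure k/k)), ∀ x ∈ E.field, σ x ∈ E.field) :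
    (weilSubgroup φ E).Normal where
  conj_mem n hn z e := by
    change φ (z * n * z⁻¹) e = e
    have h1 : φ n (φ z⁻¹ e) = φ z⁻¹ e := hn ⟨φ z⁻¹ e, hE _ _ e.2⟩
    rw [map_mul, map_mul, AlgEquiv.mul_apply, AlgEquiv.mul_apply, h1, ← AlgEquiv.mul_apply,
      ← map_mul, mul_inv_cancel, map_one, AlgEquiv.one_apply]

/-- Let `E` be a finite normal extension of `k`. If `g ∈ W_E` has class `a ∈ Eˣ` in `W_E^{ab}` and
class `b ∈ kˣ` in `W^{ab}`, then `b` is a product of conjugates of `a`. This follows by computing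
the transfer of `g`. -/
theorem exists_prod_conjugates_eq (W : WeilGroup (localData k O)) (E : FinExt k)
    (hE : ∀ (σ : Gal(AlgebraicClosure k/k)), ∀ x ∈ E.field, σ x ∈ E.field)
    (g : weilSubgroup W.φ E) (a : E.fieldˣ) (b : kˣ) (ha : weilClass W.φ E g = W.r E a)
    (hb : weilClass W.φ (FinExt.base k) (toBase W g) =
      W.r (FinExt.base k) (Units.map (algebraMap k (FinExt.base k).field).toMonoidHom b)) :
    ∃ (ι : Type u) (_ : Fintype ι) (_ : Nonempty ι) (τ : ι → E.field →ₐ[k] E.field),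
      algebraMap k E.field b = ∏ i, τ i a := by
  have hnormal := weilSubgroup_normal W.φ E hE
  let b' : E.fieldˣ := Units.map (algebraMap k E.field).toMonoidHom b
  have htr := W.transfer (E := FinExt.base k) (E' := E) bot_le
    (Units.map (algebraMap k (FinExt.base k).field).toMonoidHom b) b' (Units.ext rfl)
    (toBase W g) hb
  let H := (weilSubgroup W.φ E).subgroupOf (weilSubgroup W.φ (FinExt.base k))
  let Q := Quotient (MulAction.orbitRel (Subgroup.zpowers (toBase W (g : W.W)))
    (weilSubgroup W.φ (FinExt.base k) ⧸ H))
  let hQ : Fintype Q := Fintype.ofFinite Q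
  let y : Q → weilSubgroup W.φ (FinExt.base k) := fun q => q.out.out
  let τ : Q → (E.field →ₐ[k] E.field) := fun q => restrictHom E (W.φ (y q : W.W)⁻¹) (hE _)
  refine ⟨Q, hQ, ⟨Quotient.mk _ (QuotientGroup.mk 1)⟩, τ, ?_⟩
  rw [weilTransfer, MonoidHom.transfer_eq_prod_quotient_orbitRel_zpowers_quot] at htr
  -- `g` acts trivially on the cosets of the normal subgroup `W_E`, so each orbit has one element.
  have hfactor : ∀ q : Q, Function.minimalPeriod (toBase W (g : W.W) • ·) q.out = 1 := by
    intro q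
    rw [Function.minimalPeriod_eq_one_iff_isFixedPt]
    induction q.out using QuotientGroup.induction_on with | H z => ?_
    refine QuotientGroup.eq.2 ?_
    change (((toBase W (g : W.W) * z)⁻¹ * z : weilSubgroup W.φ (FinExt.base k)) : W.W) ∈
      weilSubgroup W.φ E
    have h2 := hnormal.conj_mem _ (inv_mem g.2) (z : W.W)⁻¹
    rw [inv_inv] at h2
    simpa [mul_assoc, toBase] using h2
  have hsurj : ∀ q, Function.Surjective (τ q) := fun q e =>
    ⟨⟨W.φ (y q : W.W) e, hE _ _ e.2⟩, Subtype.ext (by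
      change W.φ (y q : W.W)⁻¹ (W.φ (y q : W.W) e) = e
      rw [← AlgEquiv.mul_apply, ← map_mul, inv_mul_cancel, map_one, AlgEquiv.one_apply])⟩
  have hprod : W.r E b' = ∏ q : Q, W.r E (Units.map (τ q : E.field →* E.field) a) := by
    refine htr.symm.trans (Finset.prod_congr rfl fun q _ => ?_)
    refine W.conj (τ q) (y q : W.W)⁻¹ (hsurj q) (fun _ => rfl) a _ rfl g _ ?_ ha
    change (((y q)⁻¹ * toBase W (g : W.W) ^ _ * y q : weilSubgroup W.φ (FinExt.base k)) : W.W) = _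
    rw [hfactor q, pow_one, inv_inv]
    rfl
  have h4 : b' = ∏ q : Q, Units.map (τ q : E.field →* E.field) a :=
    (W.r E).injective (hprod.trans (map_prod (W.r E) _ Finset.univ).symm)
  have h3 := congrArg Units.val h4
  rw [Units.coe_prod] at h3
  exact h3

end Transfer

/-! ### Units act through inertia -/

section LocalInertia

variable {k : Type u} [Field k] {O : Subring k}

/-- The action of the absolute Galois group on the integral closure of `O` in `k̄`. -/
noncomputable def integralClosureMap (O : Subring k) (σ : Gal(AlgebraicClosure k/k)) :
    integralClosure O (AlgebraicClosure k) →+* integralClosure O (AlgebraicClosure k) :=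
  ((σ : AlgebraicClosure k →+* AlgebraicClosure k).comp
    (integralClosure O (AlgebraicClosure k)).val.toRingHom).codRestrict
    (integralClosure O (AlgebraicClosure k)).toSubring fun x =>
      x.2.map ((σ : AlgebraicClosure k →ₐ[k] AlgebraicClosure k).restrictScalars O)

@[simp]
theorem coe_integralClosureMap (σ : Gal(AlgebraicClosure k/k))
    (x : integralClosure O (AlgebraicClosure k)) :
    (integralClosureMap O σ x : AlgebraicClosure k) = σ x := rfl

/-- Two elements of the Weil group whose classes are associated uniformizers act in the same way
on the residue field of `k̄`, since both act as the Frobenius; hence their quotient acts trivially. -/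
theorem integralClosureMap_sub_mem [TopologicalSpace k] (W : WeilGroup (localData k O))
    {p₁ p₂ : integralClosure O (FinExt.base k).field} (h₁ : Irreducible p₁)
    (h : Associated p₁ p₂) {a₁ a₂ : (FinExt.base k).fieldˣ}
    (ha₁ : (a₁ : (FinExt.base k).field) = p₁) (ha₂ : (a₂ : (FinExt.base k).field) = p₂)
    (g₁ g₂ : W.W) (hg₁ : weilClass W.φ (FinExt.base k) (toBase W g₁) = W.r _ a₁)
    (hg₂ : weilClass W.φ (FinExt.base k) (toBase W g₂) = W.r _ a₂)
    (Q : Ideal (integralClosure O (AlgebraicClosure k))) [hQ : Q.IsMaximal]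
    (x : integralClosure O (AlgebraicClosure k)) :
    integralClosureMap O (W.φ (g₁ * g₂⁻¹)) x - x ∈ Q := by
  have hr := (W.reciprocity (FinExt.base k)).1
  let x' := integralClosureMap O (W.φ g₂⁻¹) x
  have e₁ : (integralClosureMap O (W.φ (g₁ * g₂⁻¹)) x : AlgebraicClosure k) = W.φ g₁ x' := by
    simp [x']
  have e₂ : (x : AlgebraicClosure k) = W.φ g₂ x' := by
    change _ = W.φ g₂ (W.φ g₂⁻¹ x)
    rw [← AlgEquiv.mul_apply, ← map_mul, mul_inv_cancel, map_one, AlgEquiv.one_apply]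
  have m₁ := hr p₁ a₁ (W.φ g₁) h₁ ha₁ ⟨_, hg₁, rfl⟩ Q hQ x' _ e₁
  have m₂ := hr p₂ a₂ (W.φ g₂) (h.irreducible h₁) ha₂ ⟨_, hg₂, rfl⟩ Q hQ x' _ e₂
  rw [← Ideal.span_singleton_eq_span_singleton.2 h] at m₂
  simpa using Q.sub_mem m₁ m₂

/-- The valuation of an element of the trivial extension. -/
noncomputable def baseValuation (ν : Valuation k (WithZero (Multiplicative ℤ))) :
    Valuation (FinExt.base k).field (WithZero (Multiplicative ℤ)) :=
  ν.comap (IntermediateField.botEquiv k (AlgebraicClosure k)).toRingEquiv.toRingHom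

theorem baseValuation_algebraMap (ν : Valuation k (WithZero (Multiplicative ℤ))) (c : k) :
    baseValuation ν (algebraMap k (FinExt.base k).field c) = ν c :=
  congrArg ν (AlgEquiv.commutes (IntermediateField.botEquiv k (AlgebraicClosure k)) c)

variable {ν : Valuation k (WithZero (Multiplicative ℤ))}

theorem baseValuation_le_one (hν : ν.Integers O) (y : integralClosure O (FinExt.base k).field) :
    baseValuation ν y ≤ 1 := by
  let e := IntermediateField.botEquiv k (AlgebraicClosure k)
  obtain ⟨c, hc⟩ : ∃ c, e.symm c = y.1 := ⟨e y.1, e.symm_apply_apply _⟩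
  have h : IsIntegral O (algebraMap k (AlgebraicClosure k) c) := by
    have h1 : algebraMap k (AlgebraicClosure k) c = (y.1 : AlgebraicClosure k) := by
      rw [← hc]; rfl
    rw [h1]
    obtain ⟨P, hP, hPy⟩ := (mem_integralClosure_iff _ _).1 y.2
    refine ⟨P, hP, ?_⟩
    have h2 := congrArg (algebraMap (FinExt.base k).field (AlgebraicClosure k)) hPy
    rw [Polynomial.hom_eval₂, map_zero] at h2
    exact h2
  have h3 : ν c ≤ 1 := hν.mem_of_integral
    ((isIntegral_algebraMap_iff (algebraMap k (AlgebraicClosure k)).injective).1 h)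
  have h4 : e y.1 = c := by rw [← hc]; exact e.apply_symm_apply c
  change ν (e y.1) ≤ 1
  rwa [h4]

theorem isUnit_of_valuation_eq_one (hν : ν.Integers O) {c : k} (hc : ν c = 1)
    {y : integralClosure O (FinExt.base k).field}
    (hy : (y : (FinExt.base k).field) = algebraMap k (FinExt.base k).field c) : IsUnit y := by
  obtain ⟨o, ho⟩ := hν.exists_of_le_one (r := c⁻¹) (by rw [map_inv₀, hc, inv_one])
  have hc0 : c ≠ 0 := (Valuation.ne_zero_iff ν).1 (by rw [hc]; exact one_ne_zero)
  refine IsUnit.of_mul_eq_one (algebraMap O _ o) (Subtype.ext ?_)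
  have h1 : ((algebraMap O (integralClosure O (FinExt.base k).field) o :
      integralClosure O (FinExt.base k).field) : (FinExt.base k).field) =
      algebraMap k (FinExt.base k).field c⁻¹ := by
    rw [← ho]; rfl
  change (y : (FinExt.base k).field) * _ = 1
  rw [h1, hy, ← map_mul, mul_inv_cancel₀ hc0, map_one]

theorem irreducible_of_baseValuation_eq (hν : ν.Integers O)
    (p : integralClosure O (FinExt.base k).field)
    (h : baseValuation ν p = WithZero.exp (-1 : ℤ)) : Irreducible p := by
  have hunit : ∀ y : integralClosure O (FinExt.base k).field, ¬ IsUnit y →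
      baseValuation ν y ≤ WithZero.exp (-1 : ℤ) := by
    intro y hy
    have h1 := baseValuation_le_one hν y
    have h2 : baseValuation ν y ≠ 1 := fun e => hy (isUnit_of_valuation_eq_one hν
      (c := IntermediateField.botEquiv k (AlgebraicClosure k) y.1) e
      ((IntermediateField.botEquiv k (AlgebraicClosure k)).injective
        (AlgEquiv.commutes (IntermediateField.botEquiv k (AlgebraicClosure k)) _).symm))
    by_cases h0 : baseValuation ν y = 0
    · exact h0.le.trans zero_le
    · have h3 := (WithZero.log_lt_iff_lt_exp (a := 0) h0).2 (lt_of_le_of_ne h1 h2)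
      exact WithZero.le_exp_of_log_le (by omega)
  have hexp : (WithZero.exp (-1 : ℤ) : WithZero (Multiplicative ℤ)) < 1 := by
    rw [← WithZero.exp_zero, WithZero.exp_lt_exp]; norm_num
  refine ⟨fun hu => ?_, fun a b hab => ?_⟩
  · obtain ⟨q, hq⟩ := hu.exists_right_inv
    have h1 : baseValuation ν p * baseValuation ν q = 1 := by
      rw [← map_mul, ← (baseValuation ν).map_one]
      exact congrArg (fun y : integralClosure O (FinExt.base k).field => baseValuation ν y) hq
    rw [h] at h1
    exact absurd h1 (ne_of_lt (mul_lt_one_of_nonneg_of_lt_one_left zero_le hexp (baseValuation_le_one hν q)))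
  · by_contra! hn
    have h3 := mul_le_mul' (hunit a hn.1) (hunit b hn.2)
    have h4 : baseValuation ν p = baseValuation ν a * baseValuation ν b := by
      rw [hab]; exact map_mul (baseValuation ν) _ _
    rw [← h4, h, ← WithZero.exp_add, WithZero.exp_le_exp] at h3
    norm_num at h3

/-- An element of the Weil group whose class in `kˣ` is a unit acts trivially on the residue field
of `k̄`: it is a quotient of two elements whose classes are uniformizers. -/
theorem integralClosureMap_sub_mem_of_valuation_eq_one [TopologicalSpace k] (hν : ν.Integers O)
    (W : WeilGroup (localData k O)) {π : kˣ} (hπ : ν π = WithZero.exp (-1 : ℤ)) {b : kˣ}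
    (hb : ν b = 1) (g : W.W)
    (hg : weilClass W.φ (FinExt.base k) (toBase W g) =
      W.r _ (Units.map (algebraMap k (FinExt.base k).field).toMonoidHom b))
    (Q : Ideal (integralClosure O (AlgebraicClosure k))) [Q.IsMaximal]
    (x : integralClosure O (AlgebraicClosure k)) :
    integralClosureMap O (W.φ g) x - x ∈ Q := by
  let m : kˣ →* (FinExt.base k).fieldˣ :=
    Units.map (algebraMap k (FinExt.base k).field).toMonoidHom
  obtain ⟨g₂, hg₂⟩ := QuotientGroup.mk'_surjective _ (W.r (FinExt.base k) (m π))
  obtain ⟨g₂, rfl⟩ : ∃ h, toBase W h = g₂ := ⟨g₂, rfl⟩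
  obtain ⟨oπ, hoπ⟩ := hν.exists_of_le_one (r := π) (by
    rw [hπ, ← WithZero.exp_zero, WithZero.exp_le_exp]; norm_num)
  obtain ⟨ob, hob⟩ := hν.exists_of_le_one (r := b) hb.le
  let A := integralClosure O (FinExt.base k).field
  have hcoe : ∀ (o : O) (c : k), algebraMap O k o = c →
      ((algebraMap O A o : A) : (FinExt.base k).field) = algebraMap k (FinExt.base k).field c := by
    rintro o c rfl; rfl
  have hu : IsUnit (algebraMap O A ob) := isUnit_of_valuation_eq_one hν hb (hcoe ob b hob)
  have hass : Associated (algebraMap O A (ob * oπ)) (algebraMap O A oπ) := by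
    rw [map_mul]
    exact associated_unit_mul_left _ _ hu
  have hirr : Irreducible (algebraMap O A oπ) := irreducible_of_baseValuation_eq hν _ (by
    rw [hcoe oπ π hoπ, baseValuation_algebraMap, hπ])
  have key := integralClosureMap_sub_mem W (p₁ := algebraMap O A (ob * oπ))
    (p₂ := algebraMap O A oπ) (hass.symm.irreducible hirr) hass (a₁ := m (b * π)) (a₂ := m π)
    (by rw [hcoe (ob * oπ) (b * π) (by rw [map_mul, hob, hoπ])]; rfl)
    (by rw [hcoe oπ π hoπ]; rfl)
    (g * g₂) g₂ (by
      have h1 : toBase W (g * g₂) = toBase W g * toBase W g₂ := rfl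
      rw [h1, map_mul, hg, map_mul]
      exact (congrArg _ hg₂).trans (map_mul (W.r (FinExt.base k)) _ _).symm) hg₂ Q x
  rwa [mul_inv_cancel_right] at key

/-- A maximal ideal of the integral closure of `O` in `k̄` contains the elements of valuation less
than `1`. -/
theorem algebraMap_mem_of_valuation_lt_one (hν : ν.Integers O)
    (Q : Ideal (integralClosure O (AlgebraicClosure k))) [hQ : Q.IsMaximal] (o : O)
    (ho : ν (algebraMap O k o) < 1) :
    algebraMap O (integralClosure O (AlgebraicClosure k)) o ∈ Q := by
  have hM := Ideal.isMaximal_comap_of_isIntegral_of_isMaximal (R := O) Q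
  by_contra hn
  obtain ⟨y, i, hi, hy⟩ := hM.exists_inv (x := o) hn
  have h1 : IsUnit i := by
    refine hν.isUnit_of_one' ?_
    have : algebraMap O k i = 1 - algebraMap O k (y * o) := by
      rw [← map_one (algebraMap O k), ← hy, map_add]; ring
    rw [this]
    refine Valuation.map_one_sub_of_lt _ ?_
    rw [map_mul, map_mul]
    exact mul_lt_one_of_nonneg_of_lt_one_right (hν.map_le_one y) zero_le ho
  exact hM.ne_top (Ideal.eq_top_of_isUnit_mem _ hi h1)

end LocalInertia

/-! ### Unramified places -/

section Unramified

variable {F : Type u} [Field F] [NumberField F]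

/-- The restriction to rings of integers of an embedding of `K` into the algebraic closure of a
completion. -/
noncomputable def ringOfIntegersMap {K k : Type u} [Field K] [Field k] (O : Subring k)
    (j : K →+* AlgebraicClosure k) : 𝓞 K →+* integralClosure O (AlgebraicClosure k) :=
  (j.comp (algebraMap (𝓞 K) K)).codRestrict
    (integralClosure O (AlgebraicClosure k)).toSubring fun x =>
      (map_isIntegral_int j (RingOfIntegers.isIntegral_coe x)).tower_top

/-- At a finite place that is unramified in the Galois extension `K`, an element of the local Weil
group whose class is a unit acts trivially on `K`. Indeed it acts trivially modulo a maximal ideal of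
the ring of integers of the algebraic closure of the completion, so its restriction to `K` lies in an
inertia group, and this is trivial. -/
theorem mem_fixingSubgroup_of_unramified {v : HeightOneSpectrum (𝓞 F)}
    (Wv : LocalWeilGroup (Place.finite v))
    (ι : AlgebraicClosure F →ₐ[F] AlgebraicClosure (Place.finite v).Completion)
    (K : FinExt F) [IsGalois F K.field]
    (hK : ∀ w : HeightOneSpectrum (𝓞 K.field), w.under (𝓞 F) = v →
      w.asIdeal.ramificationIdx (𝓞 F) = 1)
    (g : Wv.W) (hg : Wv.toResidue g = 1) (σ : Gal(AlgebraicClosure F/F))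
    (hσ : ∀ x, ι (σ x) = Wv.φ g (ι x)) : σ ∈ K.field.fixingSubgroup := by
  let k := (Place.finite v).Completion
  let O : Subring k := (Place.finite v).integers
  let ν : Valuation k (WithZero (Multiplicative ℤ)) :=
    (Valued.v : Valuation (v.adicCompletion F) _)
  have hν : ν.Integers O :=
    Valuation.integer.integers (Valued.v : Valuation (v.adicCompletion F) _)
  have hνF : ∀ x : F, ν (algebraMap F k x) = v.valuation F x := v.valuedAdicCompletion_eq_valuation'
  have hb : ν (Wv.baseClass g) = 1 := by
    rw [LocalWeilGroup.toResidue_apply] at hg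
    have h1 : (WithZero.unitsWithZeroEquiv (Units.map
        (Valued.v : Valuation (v.adicCompletion F) _).toMonoidHom (Wv.baseClass g)))⁻¹ = 1 := hg
    rw [inv_eq_one, EmbeddingLike.map_eq_one_iff, Units.ext_iff] at h1
    exact h1
  obtain ⟨π, hπ⟩ := v.valuation_exists_uniformizer F
  have hπ0 : algebraMap F k π ≠ 0 := by
    refine (map_ne_zero _).2 fun h => ?_
    rw [h, map_zero] at hπ
    exact WithZero.exp_ne_zero hπ.symm
  obtain ⟨Q, hQ⟩ := Ideal.exists_maximal (integralClosure O (AlgebraicClosure k))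
  have hact := integralClosureMap_sub_mem_of_valuation_eq_one hν Wv (π := Units.mk0 _ hπ0)
    ((hνF π).trans hπ) hb g (Wv.weilClass_toBase g) Q
  let j : K.field →+* AlgebraicClosure k := (ι : AlgebraicClosure F →+* _).comp K.field.val
  let q : Ideal (𝓞 K.field) := Q.comap (ringOfIntegersMap O j)
  have hqp : q.IsPrime := Ideal.comap_isPrime _ _
  have hle : v.asIdeal ≤ q.under (𝓞 F) := by
    intro x hx
    have h1 : ν (algebraMap F k (x : F)) < 1 := (hνF x).trans_lt ((v.valuation_lt_one_iff_mem x).2 hx)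
    have h2 := algebraMap_mem_of_valuation_lt_one hν Q
      (⟨algebraMap F k (x : F), h1.le⟩ : O) h1
    change ringOfIntegersMap O j (algebraMap (𝓞 F) (𝓞 K.field) x) ∈ Q
    convert h2 using 1
    refine Subtype.ext ?_
    exact ι.commutes (x : F)
  have hunder : v.asIdeal = q.under (𝓞 F) :=
    v.isMaximal.eq_of_le (Ideal.IsPrime.under (𝓞 F) q).ne_top hle
  have hq0 : q ≠ ⊥ := by
    intro h
    apply v.ne_bot
    rw [hunder, h]
    exact Ideal.comap_bot_of_injective _ (FaithfulSMul.algebraMap_injective (𝓞 F) (𝓞 K.field))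
  let w : HeightOneSpectrum (𝓞 K.field) := ⟨q, hqp, hq0⟩
  have hw : w.under (𝓞 F) = v := HeightOneSpectrum.ext hunder.symm
  have hram := hK w hw
  have : q.LiesOver v.asIdeal := ⟨hunder⟩
  let τ : Gal(K.field/F) := AlgEquiv.restrictNormal σ K.field
  have hτ : τ ∈ q.inertia Gal(K.field/F) := by
    intro x
    change ringOfIntegersMap O j (τ • x - x) ∈ Q
    rw [map_sub]
    convert hact (ringOfIntegersMap O j x) using 1
    congr 1
    refine Subtype.ext ?_
    refine Eq.trans ?_ (hσ (x : K.field))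
    exact congrArg ι (AlgEquiv.restrictNormal_commutes σ K.field (x : K.field))
  have hcard : Nat.card (q.inertia Gal(K.field/F)) = 1 := by
    rw [Ideal.card_inertia_eq_ramificationIdxIn (G := Gal(K.field/F)) v.asIdeal q,
      Ideal.ramificationIdxIn_eq_ramificationIdx v.asIdeal q Gal(K.field/F)]
    exact hram
  have hτ1 : τ = 1 := by
    have := (Subgroup.card_eq_one.1 hcard) ▸ hτ
    exact Subgroup.mem_bot.1 this
  intro x
  have h1 := AlgEquiv.restrictNormal_commutes σ K.field x
  change _ = σ x at h1
  change σ x = x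
  rw [← h1]
  change algebraMap K.field _ (τ x) = _
  rw [hτ1]
  rfl

end Unramified

/-! ### Completions, ideles and topological nilpotence -/

section Archimedean

theorem isAlgClosed_completion {F : Type u} [Field F] {v : InfinitePlace F} (hv : v.IsComplex) :
    IsAlgClosed v.Completion := by
  let e := InfinitePlace.Completion.ringEquivComplexOfIsComplex hv
  refine IsAlgClosed.of_exists_root _ fun p _ hp => ?_
  obtain ⟨x, hx⟩ := IsAlgClosed.exists_root (p.map e.toRingHom) (by
    rw [Polynomial.degree_map]; exact hp.degree_pos.ne')
  refine ⟨e.symm x, e.injective ?_⟩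
  change e.toRingHom (p.eval (e.symm x)) = e 0
  rw [Polynomial.eval, Polynomial.hom_eval₂, map_zero, RingHom.comp_id]
  have h : e.toRingHom (e.symm x) = x := e.apply_symm_apply x
  rwa [h, ← Polynomial.eval_map]

/-- At an archimedean place `w` unramified over `v` the extension of completions is trivial. -/
theorem algebraMap_surjective_of_isUnramified {F E : Type u} [Field F] [NumberField F] [Field E]
    [NumberField E] [Algebra F E] {v : InfinitePlace F} {w : InfinitePlace E}
    (hw : w.IsUnramified F) (hwv : w.comap (algebraMap F E) = v) {L : Type u} [Field L]
    [Algebra (Place.infinite v).Completion L] [Algebra.IsIntegral (Place.infinite v).Completion L]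
    (c : (Place.infinite w).Completion ≃+* L) :
    Function.Surjective (algebraMap (Place.infinite v).Completion L) := by
  by_cases hv : v.IsComplex
  · have : IsAlgClosed (Place.infinite v).Completion := isAlgClosed_completion hv
    exact IsAlgClosed.algebraMap_bijective_of_isIntegral.2
  · have hw' : w.IsReal := (InfinitePlace.isUnramified_iff.1 hw).resolve_right (by rwa [hwv])
    let e : (Place.infinite v).Completion ≃+* ℝ := InfinitePlace.Completion.ringEquivRealOfIsReal
      (InfinitePlace.not_isComplex_iff_isReal.1 hv)
    let e' : (Place.infinite w).Completion ≃+* ℝ :=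
      InfinitePlace.Completion.ringEquivRealOfIsReal hw'
    have h : (e'.toRingHom.comp c.symm.toRingHom).comp
        ((algebraMap (Place.infinite v).Completion L).comp e.symm.toRingHom) = RingHom.id ℝ :=
      Subsingleton.elim _ _
    intro x
    refine ⟨e.symm (e' (c.symm x)), c.symm.injective (e'.injective ?_)⟩
    exact congrArg (fun f : ℝ →+* ℝ => f (e' (c.symm x))) h

end Archimedean

section Ideles

variable {E : Type u} [Field E] [NumberField E]

open Classical in
theorem Ideles.exists_isSingle (w : Place E) (a : w.Completionˣ) :
    ∃ x : Ideles E, Ideles.IsSingle w a x := by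
  rcases w with w | w
  · change (w.adicCompletion E)ˣ at a
    let s : w.adicCompletion E → FiniteAdeleRing (𝓞 E) E := fun b =>
      RestrictedProduct.mulSingle (fun w : HeightOneSpectrum (𝓞 E) => w.adicCompletionIntegers E) w b
    have hs : ∀ b c : w.adicCompletion E, b * c = 1 → s b * s c = 1 := fun b c h => by
      refine (RestrictedProduct.mulSingle_mul _ w b c).symm.trans ?_
      rw [h]
      exact RestrictedProduct.mulSingle_one _ w
    let x : Ideles E := ⟨((1, s a) : InfiniteAdeleRing E × FiniteAdeleRing (𝓞 E) E),
      ((1, s ((a⁻¹ : (w.adicCompletion E)ˣ) : w.adicCompletion E)) :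
        InfiniteAdeleRing E × FiniteAdeleRing (𝓞 E) E),
      Prod.ext (mul_one _) (hs _ _ a.mul_inv), Prod.ext (mul_one _) (hs _ _ a.inv_mul)⟩
    refine ⟨x, Units.ext (RestrictedProduct.mulSingle_eq_same
      (fun w : HeightOneSpectrum (𝓞 E) => w.adicCompletionIntegers E) w (a : w.adicCompletion E)),
      fun w' hw' => Units.ext ?_⟩
    rcases w' with w' | w'
    · exact RestrictedProduct.mulSingle_eq_of_ne
        (fun w : HeightOneSpectrum (𝓞 E) => w.adicCompletionIntegers E) _ fun h => hw' (congrArg _ h)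
    · rfl
  · change w.Completionˣ at a
    let s : w.Completion → InfiniteAdeleRing E := fun b =>
      (Pi.mulSingle w b : (w : InfinitePlace E) → w.Completion)
    have hs : ∀ b c : w.Completion, b * c = 1 → s b * s c = 1 := fun b c h => by
      refine (Pi.mulSingle_mul w b c).symm.trans ?_
      rw [h]
      exact Pi.mulSingle_one w
    let x : Ideles E := ⟨((s a, 1) : InfiniteAdeleRing E × FiniteAdeleRing (𝓞 E) E),
      ((s ((a⁻¹ : w.Completionˣ) : w.Completion), 1) :
        InfiniteAdeleRing E × FiniteAdeleRing (𝓞 E) E),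
      Prod.ext (hs _ _ a.mul_inv) (mul_one _), Prod.ext (hs _ _ a.inv_mul) (mul_one _)⟩
    refine ⟨x, Units.ext (Pi.mulSingle_eq_same (M := fun w : InfinitePlace E => w.Completion) w
      (a : w.Completion)),
      fun w' hw' => Units.ext ?_⟩
    rcases w' with w' | w'
    · rfl
    · exact Pi.mulSingle_eq_of_ne (M := fun w : InfinitePlace E => w.Completion)
        (fun h => hw' (congrArg _ h)) _

end Ideles

section Nilpotent

variable {k : Type u} [Field k] [TopologicalSpace k] [IsTopologicalRing k]

theorem isTopologicallyNilpotent_prod {R ι : Type*} [CommRing R] [TopologicalSpace R]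
    [IsTopologicalRing R] [Fintype ι] [Nonempty ι] {f : ι → R}
    (hf : ∀ i, IsTopologicallyNilpotent (f i)) : IsTopologicallyNilpotent (∏ i, f i) := by
  have h := tendsto_finsetProd Finset.univ fun i _ => hf i
  rw [Finset.prod_const, Finset.card_univ, zero_pow Fintype.card_ne_zero] at h
  simpa only [IsTopologicallyNilpotent, Finset.prod_pow] using h

/-- Topological nilpotence of an element of `k` can be tested in a finite extension. -/
theorem isTopologicallyNilpotent_of_algebraMap {L : Type*} [Field L] [Algebra k L]
    [TopologicalSpace L] [IsModuleTopology k L] {b : k}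
    (h : IsTopologicallyNilpotent (algebraMap k L b)) : IsTopologicallyNilpotent b := by
  obtain ⟨r, hr⟩ := LinearMap.exists_leftInverse_of_injective (Algebra.linearMap k L)
    (LinearMap.ker_eq_bot.2 (algebraMap k L).injective)
  have hc : Continuous r := IsModuleTopology.continuous_of_linearMap r
  have h1 := (hc.tendsto 0).comp h
  rw [map_zero] at h1
  refine h1.congr fun n => ?_
  change r (algebraMap k L b ^ n) = b ^ n
  rw [← map_pow]
  exact LinearMap.congr_fun hr (b ^ n)

variable {O : Subring k}

/-- If an element of `W_E`, for a finite normal extension `E` of `k`, has topologically nilpotent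
class in `Eˣ`, then its class in `kˣ` is topologically nilpotent as well, being a product of
conjugates of the former. -/
theorem isTopologicallyNilpotent_of_weilClass (W : WeilGroup (localData k O)) (E : FinExt k)
    (hE : ∀ (σ : Gal(AlgebraicClosure k/k)), ∀ x ∈ E.field, σ x ∈ E.field)
    (g : weilSubgroup W.φ E) (a : E.fieldˣ) (b : kˣ) (ha : weilClass W.φ E g = W.r E a)
    (hb : weilClass W.φ (FinExt.base k) (toBase W g) =
      W.r (FinExt.base k) (Units.map (algebraMap k (FinExt.base k).field).toMonoidHom b))
    (hn : @IsTopologicallyNilpotent _ _ (moduleTopology k E.field) (a : E.field)) :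
    IsTopologicallyNilpotent (b : k) := by
  obtain ⟨ι, _, _, τ, h⟩ := exists_prod_conjugates_eq W E hE g a b ha hb
  let _ : TopologicalSpace E.field := moduleTopology k E.field
  have : IsModuleTopology k E.field := ⟨rfl⟩
  have := IsModuleTopology.isTopologicalRing k E.field
  refine isTopologicallyNilpotent_of_algebraMap (L := E.field) ?_
  rw [h]
  refine isTopologicallyNilpotent_prod fun i => ?_
  exact hn.map (φ := τ i) (IsModuleTopology.continuous_of_linearMap (τ i).toLinearMap)

end Nilpotent

/-! ### Weil maps at the places outside `S` -/

section WeilMap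

/-- The composite `F_v · ι(K)` is normal over `F_v` if `K` is normal over `F`. -/
theorem apply_mem_adjoin_of_normal {F : Type u} [Field F] {k : Type u} [Field k] [Algebra F k]
    (ι : AlgebraicClosure F →ₐ[F] AlgebraicClosure k) (K : FinExt F) [Normal F K.field]
    (σ : Gal(AlgebraicClosure k/k)) (x : AlgebraicClosure k)
    (hx : x ∈ IntermediateField.adjoin k (ι '' (K.field : Set (AlgebraicClosure F)))) :
    σ x ∈ IntermediateField.adjoin k (ι '' (K.field : Set (AlgebraicClosure F))) := by
  have h : (IntermediateField.adjoin k (ι '' (K.field : Set (AlgebraicClosure F)))).map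
      (σ : AlgebraicClosure k →ₐ[k] AlgebraicClosure k) ≤
      IntermediateField.adjoin k (ι '' (K.field : Set (AlgebraicClosure F))) := by
    rw [IntermediateField.adjoin_map, IntermediateField.adjoin_le_iff]
    rintro _ ⟨_, ⟨e, he, rfl⟩, rfl⟩
    let j : K.field →ₐ[F] AlgebraicClosure k := ι.comp K.field.val
    have : Normal F j.fieldRange := Normal.of_algEquiv (AlgEquiv.ofInjectiveField j)
    let f : j.fieldRange →ₐ[F] AlgebraicClosure k :=
      ((σ : AlgebraicClosure k →ₐ[k] AlgebraicClosure k).restrictScalars F).comp j.fieldRange.val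
    have h1 : σ (ι e) ∈ f.fieldRange := ⟨⟨ι e, ⟨e, he⟩, rfl⟩, rfl⟩
    rw [AlgHom.fieldRange_of_normal] at h1
    obtain ⟨e', he'⟩ := h1
    refine IntermediateField.subset_adjoin _ _ ⟨e', e'.2, he'⟩
  exact h ⟨x, hx, rfl⟩

variable {F : Type u} [Field F] [NumberField F]

/-- Let `K/F` be a finite Galois extension and `S` a set of places that contains the places that
ramify in `K`. For `v ∉ S` the Weil map at `v` sends the kernel of the residue map into `N_{K,S}`. -/
theorem IsWeilMap.apply_mem_weilKernel {W : GlobalWeilGroup F} {v : Place F}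
    {Wv : LocalWeilGroup v} {θ : Wv.W →* W.W} (hθ : IsWeilMap W Wv θ) (K : FinExt F)
    [IsGalois F K.field] {S : Finset (Place F)}
    (hS : ∀ w : Place K.field, w.IsRamified F → w.under F ∈ S) (hv : v ∉ S) {g : Wv.W}
    (hg : Wv.toResidue g = 1) : θ g ∈ weilKernel W K S := by
  obtain ⟨ι, hι, hE⟩ := hθ.compatible
  obtain ⟨Ev, w, c, hEv, hc, hcι, hsingle⟩ := hE K
  let _ : TopologicalSpace Ev.field := moduleTopology v.Completion Ev.field
  have : IsModuleTopology v.Completion Ev.field := ⟨rfl⟩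
  have := IsModuleTopology.isTopologicalRing v.Completion Ev.field
  have hcs : Continuous c.symm := hc.homeomorph.symm.continuous.congr fun x =>
    c.injective ((hc.homeomorph.apply_symm_apply x).trans (c.apply_symm_apply x).symm)
  have hcF : ∀ e : F, c (algebraMap K.field w.Completion (algebraMap F K.field e)) =
      algebraMap v.Completion Ev.field (algebraMap F v.Completion e) := fun e =>
    Subtype.ext ((hcι _).trans (ι.commutes e))
  -- `c` is a homeomorphism, so an element of `F` that is topologically nilpotent at `v` is so at `w`.
  have hwv : w.under F = v := by
    refine Place.under_eq_of_isTopologicallyNilpotent v w fun e he => ?_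
    rw [← c.symm_apply_apply (algebraMap K.field w.Completion _), hcF]
    refine IsTopologicallyNilpotent.map (φ := c.symm) hcs (IsTopologicallyNilpotent.map
      (φ := algebraMap v.Completion Ev.field) ?_ he)
    exact IsModuleTopology.continuous_of_linearMap (Algebra.linearMap v.Completion Ev.field)
  have hfix : ∀ e ∈ K.field, Wv.φ g (ι e) = ι e := by
    rcases v with v | v
    · intro e he
      have hσ : W.φ (θ g) ∈ K.field.fixingSubgroup := by
        refine mem_fixingSubgroup_of_unramified Wv ι K (fun w' hw' => ?_) g hg _ (hι g)
        by_contra hram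
        refine hv ?_
        have := hS (Place.finite w') hram
        rwa [Place.under, hw'] at this
      rw [← hι]
      exact congrArg ι (hσ ⟨e, he⟩)
    · rcases w with w | w
      · exact absurd hwv (by simp [Place.under])
      · have hw : w.IsUnramified F := by
          by_contra hram
          exact hv (hwv ▸ hS (Place.infinite w) hram)
        have hsurj := algebraMap_surjective_of_isUnramified hw (Place.infinite.inj hwv)
          (L := Ev.field) c
        intro e he
        have hmem : ι e ∈ Ev.field := by
          rw [hEv]
          exact IntermediateField.subset_adjoin _ _ ⟨e, he, rfl⟩
        obtain ⟨y, hy⟩ := hsurj ⟨ι e, hmem⟩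
        have hy' : algebraMap _ (AlgebraicClosure (Place.infinite v).Completion) y = ι e :=
          congrArg Subtype.val hy
        rw [← hy']
        exact (Wv.φ g).commutes y
  have hK : θ g ∈ weilSubgroup W.φ K := fun e => ι.injective ((hι g e).trans (hfix e e.2))
  have hgE : g ∈ weilSubgroup Wv.φ Ev := by
    rintro ⟨x, hx⟩
    change Wv.φ g x = x
    rw [hEv] at hx
    induction hx using IntermediateField.adjoin_induction with
    | mem x hx =>
      obtain ⟨e, he, rfl⟩ := hx
      exact hfix e he
    | algebraMap y => exact (Wv.φ g).commutes y
    | add x y _ _ hx hy => rw [map_add, hx, hy]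
    | inv x _ hx => rw [map_inv₀, hx]
    | mul x y _ _ hx hy => rw [map_mul, hx, hy]
  have hnormal : ∀ (σ : Gal(AlgebraicClosure v.Completion/v.Completion)), ∀ x ∈ Ev.field,
      σ x ∈ Ev.field := by
    rw [hEv]
    exact apply_mem_adjoin_of_normal ι K
  -- The class `a` of `g` in `E_vˣ` is a unit, since the class of `g` in `F_vˣ` is one.
  let a : Ev.fieldˣ := (Wv.r Ev).symm (weilClass Wv.φ Ev ⟨g, hgE⟩)
  have ha : weilClass Wv.φ Ev ⟨g, hgE⟩ = Wv.r Ev a := ((Wv.r Ev).apply_symm_apply _).symm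
  have hb := Wv.weilClass_toBase g
  have hg' := (Place.valuation_eq_one_iff v (Wv.baseClass g)).1 hg
  let a' : w.Completionˣ := Units.map (c.symm : Ev.field →* w.Completion) a
  have hca : ∀ a : Ev.fieldˣ, Units.map (c : w.Completion →* Ev.field)
      (Units.map (c.symm : Ev.field →* w.Completion) a) = a := fun a =>
    Units.ext (c.apply_symm_apply _)
  have hval : w.valuation a' = 1 := by
    rw [Place.valuation_eq_one_iff]
    constructor
    · intro hn
      refine hg'.1 (isTopologicallyNilpotent_of_weilClass Wv Ev hnormal ⟨g, hgE⟩ a _ ha hb ?_)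
      have := hn.map (φ := c) hc.continuous
      exact (congrArg IsTopologicallyNilpotent (c.apply_symm_apply (a : Ev.field))).mp this
    · intro hn
      refine hg'.2 (isTopologicallyNilpotent_of_weilClass Wv Ev hnormal ⟨g, hgE⟩⁻¹ a⁻¹
        (Wv.baseClass g)⁻¹ ?_ ?_ ?_)
      · rw [map_inv, ha]
        exact (map_inv (Wv.r Ev) a).symm
      · have h1 : toBase Wv ((⟨g, hgE⟩⁻¹ : weilSubgroup Wv.φ Ev) : Wv.W) = (toBase Wv g)⁻¹ := rfl
        rw [h1, map_inv, hb, map_inv]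
        exact (map_inv (Wv.r _) _).symm
      · have := hn.map (φ := c) hc.continuous
        exact (congrArg IsTopologicallyNilpotent
          (c.apply_symm_apply ((a⁻¹ : Ev.fieldˣ) : Ev.field))).mp this
  obtain ⟨x, hx⟩ := Ideles.exists_isSingle w a'
  refine Subgroup.subset_normalClosure ⟨⟨θ g, hK⟩, rfl, x, fun w' => ?_,
    hsingle a' x hx ⟨g, hgE⟩ ⟨θ g, hK⟩ rfl ?_⟩
  · by_cases hw' : w' = w
    · subst hw'
      exact ⟨fun h => absurd (hwv ▸ h) hv, fun _ => by rw [hx.1, hval]⟩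
    · rw [hx.2 w' hw']
      exact ⟨fun _ => rfl, fun _ => map_one _⟩
  · rw [hca]
    exact ha

/-- For `v ∉ S` the Weil map at `v` induces a continuous homomorphism from `W_{κ(v)}` to
`W_{K/F,S}`. -/
theorem IsWeilMap.exists_residue_lift {W : GlobalWeilGroup F} {v : Place F}
    {Wv : LocalWeilGroup v} {θ : Wv.W →* W.W} (hθ : IsWeilMap W Wv θ) (K : FinExt F)
    [IsGalois F K.field] {S : Finset (Place F)}
    (hS : ∀ w : Place K.field, w.IsRamified F → w.under F ∈ S) (hv : v ∉ S) :
    ∃ h : v.ResidueGroup →* SWeilGroup W K S, Continuous h ∧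
      ∀ g, h (Wv.toResidue g) = QuotientGroup.mk' (weilKernel W K S) (θ g) := by
  let f : Wv.W →* SWeilGroup W K S := (QuotientGroup.mk' (weilKernel W K S)).comp θ
  have hker : Wv.toResidue.ker ≤ f.ker := fun g hg =>
    (QuotientGroup.eq_one_iff _).2 (hθ.apply_mem_weilKernel K hS hv hg)
  let h := Wv.toResidue.liftOfSurjective Wv.toResidue_surjective ⟨f, hker⟩
  have hcomp : ∀ g, h (Wv.toResidue g) = f g := fun g =>
    Wv.toResidue.liftOfRightInverse_comp_apply _ _ ⟨f, hker⟩ g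
  refine ⟨h, Wv.continuous_of_comp_toResidue h ?_, hcomp⟩
  simp only [hcomp]
  exact continuous_quotient_mk'.comp hθ.continuous

end WeilMap

end WeilEtale

theorem theorem4p8 {F : Type u} [Field F] [NumberField F]
    (W : GlobalWeilGroup F) (Wl : ∀ v : Place F, LocalWeilGroup v)
    (θ : ∀ v : Place F, (Wl v).W →* W.W) (hθ : ∀ v : Place F, IsWeilMap W (Wl v) (θ v))
    (K : FinExt F) [IsGalois F K.field] (S : Finset (Place F))
    (hS : ∀ w : Place K.field, w.IsRamified F → w.under F ∈ S)
    (A : Type u) [AddCommGroup A] [TopologicalSpace A] [IsTopologicalAddGroup A]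
    [DistribMulAction W.W A] [ContinuousSMul W.W A]
    (q : ℕ) (hq : 0 < q) :
    IsIso ((weilDiagram W Wl θ K S).toProd S
      (((weilDiagram W Wl θ K S).genHigherDirectImage q).obj (tildeSheaf W Wl θ K S A))) := by
  have : ContinuousMul (weilDiagram W Wl θ K S).generic :=
    inferInstanceAs (ContinuousMul (SWeilGroup W K S))
  have : ∀ v, ContinuousMul ((weilDiagram W Wl θ K S).special v) := fun v =>
    inferInstanceAs (ContinuousMul v.ResidueGroup)
  refine GroupDiagram.isIso_toProd ((weilDiagram W Wl θ K S).isSupportedOn_genHigherDirectImage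
    (fun v => (Wl v).toResidue_surjective) (fun v hv => ?_) _ hq)
  exact (hθ v).exists_residue_lift K hS hv
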